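/- **Setting.** Let $G$ be a finite simple undirected graph with node set $V=\{1,\dots,N\}$ and $M$ edges, and let $K_I\in\mathbb{R}^{M\times N}$ be its (oriented) incidence matrix for an arbitrary orientation of the edges, $K=K_I^{T}$. The consensus dynamics on $G$ are written as the descriptor system in the node states $x\in\mathbb R^N$ and edge states $x^e\in\mathbb R^M$ $$\begin{pmatrix} I&0\\0&0\end{pmatrix}\begin{pmatrix}\dot x\\ \dot x^e\end{pmatrix}=\begin{pmatrix}0&K\\K_I&W\end{pmatrix}\begin{pmatrix}x\\x^e\end{pmatrix},$$ where $W$ is diagonal and its diagonal entries are free parameters. With $n=N+M$, put $$Q_F=\begin{pmatrix} I&0\\0&0\end{pmatrix},\quad Q_A=\begin{pmatrix}0&K\\K_I&0\end{pmatrix},\quad T_A=\begin{pmatrix}0&0\\0&W\end{pmatrix},$$ and for $S\subseteq V$ let $T_B(S)$ be the $n\times n$ diagonal matrix with a free parameter in position $(i,i)$ for each node $i\in S$ and zeros elsewhere. *The matroid $\mathcal M_1$ on $V$* has the rank function $$\rho_1(S)=\operatorname{rank}\bigl(\mathcal M([I|Q_A|0])\vee\mathcal M([I|T_A|T_B(S)])\bigr)-\operatorname{rank}\bigl(\mathcal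 M([I|Q_A|0])\vee\mathcal M([I|T_A|0])\bigr),$$ where $\mathcal M(\cdot)$ is the column matroid (for generic values of the free parameters) and $\vee$ is matroid union. *The matroid $\mathcal M_2$ on $V$.* Let $\Omega$ be the $2n\times n$ matrix with the rows of $Q_A-Q_F$, indexed by $w_i$ and $w_e$ ($i$ a node, $e$ an edge), above the rows of the identity, indexed by $x_i$ and $x_e$. Let $J=\{w_i : i\in V\}\cup\{x_e : e \text{ an edge}\}$, let $\Omega_J$ be the (invertible) submatrix of rows in $J$, and $\tilde\Omega=\Omega\,\Omega_J^{-1}$, with columns indexed by $J$. The auxiliary digraph $G'$ has two vertices $v^T,v^Q$ for every row index $v$ of $\Omega$, and the edges $(x_e^Q,w_e^T)$ and $(w_e^T,w_e^Q)$ for all edges $e$, $(w_i^Q,w_i^T)$ for all nodes $i$, and $(v^Q,y^Q)$ whenever $v\notin J$, $y\in J$ and $\tilde\Omega_{vy}\neq0$. Call a strongly connected component of $G'$ extremal if its vertices lie on directed cycles and no vertex of another component that lies on a cycle can be reached from it. Then $\rho_2(S)$ is the number of extremal components from which some $w_s^T$ with $s\in S$ can be reached, and $\mathcal M_2$ is the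 matroid with rank function $\rho_2$. Let $\mathcal M_j^*$ denote the dual matroid of $\mathcal M_j$. For $f:2^V\to\mathbb R_{\ge 0}$ and $k\in\mathbb N$ consider the problem of selecting input nodes for performance under the controllability constraint, $$\text{maximize } f(S)\quad\text{s.t. } (V\setminus S)\in\mathcal M_1^*\cap\mathcal M_2^*,\ |S|\le k.\tag{1}$$ **Theorem.** (a) There is an algorithm which, given $G$, $k$ and a value oracle for a nonnegative monotone submodular function $f$ of the form $f(S)=\sum_{i=1}^{r}f_i(S\cap V_i)$, where $V_1,\dots,V_r$ are the node sets of the connected components of $G$, halts within a number of steps that is polynomial in $N$ and, whenever (1) has a feasible set, outputs a feasible set $S$ with $f(S)\ge(1-1/e)\,f(S')$ for every feasible $S'$. (b) If $G$ is (strongly) connected, that is, if there is a path between any two nodes, the same holds for every nonnegative monotone submodular function $f$: there is an algorithm which on all such $G$, all $k$ and all such $f$ halts within a number of steps polynomial in $N$ and outputs a feasible set $S$ with $f(S)\ge(1-1/e)\,f(S')$ for every feasible $S'$, whenever (1) has a feasible set. Steps are those of a deterministic random access machine that reads $G$ by adjacency tests and $f$ by the value oracle, compares, adds and subtracts oracle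 values, and in which each elementary instruction, test and oracle call costs one step. -/

import Mathlib

/-! ### Set functions -/

/-- A nonnegative, monotone, submodular set function. -/
structure IsMonotoneSubmodular {V : Type*} [DecidableEq V] (f : Finset V → ℝ) : Prop where
  nonneg : ∀ A, 0 ≤ f A
  mono : ∀ A B, A ⊆ B → f A ≤ f B
  submodular : ∀ A B, A ⊆ B → ∀ v, v ∉ B →
    f (insert v B) - f B ≤ f (insert v A) - f A

open scoped Classical in
/-- `f(S) = ∑ᵢ fᵢ(S ∩ Vᵢ)`, where the `Vᵢ` are the vertex sets of the connected components. -/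
def IsSeparableOverComponents {V : Type*} (G : SimpleGraph V) (f : Finset V → ℝ) : Prop :=
  ∃ g : G.ConnectedComponent → Finset V → ℝ,
    ∀ S, f S = ∑ᶠ c, g c (S.filter (fun v => G.connectedComponentMk v = c))

/-! ### Matroids presented by independent sets or by a rank function -/

/-- The independent sets of the matroid union. -/
def UnionIndep {γ : Type*} [DecidableEq γ] (I₁ I₂ : Finset γ → Prop) (X : Finset γ) : Prop :=
  ∃ X₁ X₂, I₁ X₁ ∧ I₂ X₂ ∧ X = X₁ ∪ X₂

open scoped Classical in
/-- The rank of a matroid: the largest size of an independent set. -/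
noncomputable def indepRank {γ : Type*} [Fintype γ] (I : Finset γ → Prop) : ℕ :=
  (Finset.univ.filter I).sup Finset.card

/-- The independent sets of the matroid with rank function `ρ`. -/
def RankIndep {V : Type*} (ρ : Finset V → ℕ) (X : Finset V) : Prop :=
  ρ X = X.card

/-- The bases of the matroid with rank function `ρ`. -/
def RankBasis {V : Type*} (ρ : Finset V → ℕ) (B : Finset V) : Prop :=
  Maximal (RankIndep ρ) B

/-- The independent sets of the dual of the matroid with rank function `ρ`: the sets contained
in the complement of a basis. -/
def RankDualIndep {V : Type*} [Fintype V] [DecidableEq V] (ρ : Finset V → ℕ)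
    (R : Finset V) : Prop :=
  ∃ B, RankBasis ρ B ∧ R ⊆ Bᶜ

/-! ### Structured descriptor systems -/

/-- A descriptor system `(Q_F + T_F) ẋ = (Q_A + T_A) x`: `QF`, `QA` are the fixed matrices, and
`TF i j`, `TA i j` say that the `(i, j)` entry of `T_F`, `T_A` is a free parameter (the other
entries of `T_F`, `T_A` are zero). -/
structure StructuredSystem (ι : Type*) where
  QF : Matrix ι ι ℝ
  QA : Matrix ι ι ℝ
  TF : ι → ι → Prop
  TA : ι → ι → Prop

namespace StructuredSystem

variable {ι : Type*} [Fintype ι] [DecidableEq ι]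

/-- The matrix `[I | X | Y]`. -/
def augmented (X Y : Matrix ι ι ℝ) : Matrix ι (ι ⊕ (ι ⊕ ι)) ℝ :=
  Matrix.fromCols 1 (Matrix.fromCols X Y)

/-- Independence in the linear matroid of the columns of `M`. -/
def ColIndep {γ : Type*} (M : Matrix ι γ ℝ) (X : Finset γ) : Prop :=
  LinearIndependent ℝ (fun j : X => M.col j)

/-- Independence in the matroid `M([I | Q_A | 0])`. -/
def FixedIndep (sys : StructuredSystem ι) (X : Finset (ι ⊕ (ι ⊕ ι))) : Prop :=
  ColIndep (augmented sys.QA 0) X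

/-- Independence in the matroid `M([I | T_A | T_B(S)])` of a matrix of free parameters, where
`T_B(S)` is diagonal with a free parameter at `(i, i)` for `i ∈ S` and zero elsewhere: the columns
are independent for generic, equivalently for some, values of the parameters. -/
def FreeIndep (sys : StructuredSystem ι) (S : Finset ι) (X : Finset (ι ⊕ (ι ⊕ ι))) : Prop :=
  ∃ TA TB : Matrix ι ι ℝ, (∀ i j, ¬ sys.TA i j → TA i j = 0) ∧
    (∀ i j, ¬ (i = j ∧ i ∈ S) → TB i j = 0) ∧ ColIndep (augmented TA TB) X

/-- `ρ₁(S) = rank(M([I|Q_A|0]) ∨ M([I|T_A|T_B(S)])) - rank(M([I|Q_A|0]) ∨ M([I|T_A|0]))`. -/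
noncomputable def rho₁ (sys : StructuredSystem ι) (S : Finset ι) : ℕ :=
  indepRank (UnionIndep sys.FixedIndep (sys.FreeIndep S)) -
    indepRank (UnionIndep sys.FixedIndep (sys.FreeIndep ∅))

/-- The matrix `Ω` without its input block; `Sum.inl i` is the row `wᵢ` and `Sum.inr i` the
row `xᵢ`. -/
def Omega (sys : StructuredSystem ι) : Matrix (ι ⊕ ι) ι ℝ :=
  Matrix.fromRows (sys.QA - sys.QF) 1

/-- A perfect matching of the bipartite graph `H`, with `m i = Sum.inl i` for `m(wᵢᵀ) = wᵢ^Q` and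
`m i = Sum.inr j` for `m(wᵢᵀ) = xⱼ^Q`, whose set `J` of matched rows is linearly independent
in `Ω`. -/
structure AuxMatching (sys : StructuredSystem ι) where
  m : ι → ι ⊕ ι
  injective : Function.Injective m
  edge : ∀ i, m i = Sum.inl i ∨ ∃ j, (sys.TA i j ∨ sys.TF i j) ∧ m i = Sum.inr j
  independent : LinearIndependent ℝ (fun i => sys.Omega.row (m i))

/-- `Ω Ω_J⁻¹`; the columns are indexed by `J`, column `i` being `m i`. -/
noncomputable def OmegaTilde (sys : StructuredSystem ι) (μ : sys.AuxMatching) :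
    Matrix (ι ⊕ ι) ι ℝ :=
  sys.Omega * (sys.Omega.submatrix μ.m id)⁻¹

/-- The vertices of the auxiliary graph: the copies `wᵢᵀ, xᵢᵀ` and the copies `wᵢ^Q, xᵢ^Q`. -/
abbrev AuxVertex (ι : Type*) := (ι ⊕ ι) ⊕ (ι ⊕ ι)

/-- The vertex `wᵢᵀ`. -/
abbrev wT {ι : Type*} (i : ι) : AuxVertex ι := Sum.inl (Sum.inl i)

/-- The vertex `v^Q` for a row `v` of `Ω`. -/
abbrev vQ {ι : Type*} (v : ι ⊕ ι) : AuxVertex ι := Sum.inr v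

/-- The edges of the auxiliary graph with empty input set. -/
inductive AuxEdge (sys : StructuredSystem ι) (μ : sys.AuxMatching) :
    AuxVertex ι → AuxVertex ι → Prop
  | freeUnmatched (i j : ι) : (sys.TA i j ∨ sys.TF i j) → μ.m i ≠ Sum.inr j →
      AuxEdge sys μ (wT i) (vQ (Sum.inr j))
  | freeMatched (i j : ι) : (sys.TA i j ∨ sys.TF i j) → μ.m i = Sum.inr j →
      AuxEdge sys μ (vQ (Sum.inr j)) (wT i)
  | copyUnmatched (i : ι) : μ.m i ≠ Sum.inl i → AuxEdge sys μ (wT i) (vQ (Sum.inl i))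
  | copyMatched (i : ι) : μ.m i = Sum.inl i → AuxEdge sys μ (vQ (Sum.inl i)) (wT i)
  | fixed (v : ι ⊕ ι) (i : ι) : v ∉ Set.range μ.m → sys.OmegaTilde μ v i ≠ 0 →
      AuxEdge sys μ (vQ v) (vQ (μ.m i))

/-- There is a (possibly empty) directed path from `u` to `v` in the auxiliary graph. -/
def AuxReach (sys : StructuredSystem ι) (μ : sys.AuxMatching) (u v : AuxVertex ι) : Prop :=
  Relation.ReflTransGen (sys.AuxEdge μ) u v

/-- `v` lies on a directed cycle of the auxiliary graph. -/
def AuxOnCycle (sys : StructuredSystem ι) (μ : sys.AuxMatching) (v : AuxVertex ι) : Prop :=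
  Relation.TransGen (sys.AuxEdge μ) v v

/-- The class of `v` under mutual reachability. -/
def auxClass (sys : StructuredSystem ι) (μ : sys.AuxMatching) (v : AuxVertex ι) :
    Set (AuxVertex ι) :=
  {u | sys.AuxReach μ u v ∧ sys.AuxReach μ v u}

/-- The classes of vertices on cycles that are extremal in the acyclic quotient graph: no path
leads from them to another class of vertices on cycles. All vertices on cycles have a path
to `{wₛᵀ : s ∈ S}` iff these classes have one. -/
def extremalClasses (sys : StructuredSystem ι) (μ : sys.AuxMatching) :
    Set (Set (AuxVertex ι)) :=
  {C | ∃ v, sys.AuxOnCycle μ v ∧ C = sys.auxClass μ v ∧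
    ∀ u, sys.AuxOnCycle μ u → sys.AuxReach μ v u → u ∈ C}

/-- `ρ₂(S)`: the number of extremal classes that are connected to the input set `S`, i.e. have a
path to some `wₛᵀ` with `s ∈ S`. -/
noncomputable def rho₂ (sys : StructuredSystem ι) (μ : sys.AuxMatching) (S : Finset ι) : ℕ :=
  Set.ncard {C ∈ sys.extremalClasses μ | ∃ v ∈ C, ∃ s ∈ S, sys.AuxReach μ v (wT s)}

end StructuredSystem

/-! ### The consensus system -/

/-- An orientation of the edges of a graph; it fixes the signs in the incidence matrix. -/
structure EdgeOrientation {V : Type*} (G : SimpleGraph V) where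
  tail : G.edgeSet → V
  head : G.edgeSet → V
  ends : ∀ e, s(tail e, head e) = e.1

namespace Consensus

open StructuredSystem

variable {N : ℕ} {G : SimpleGraph (Fin N)}

/-- The incidence matrix `K_I`, with one row per edge and one column per node. -/
def incidence (o : EdgeOrientation G) : Matrix G.edgeSet (Fin N) ℝ :=
  fun e i => (if i = o.tail e then 1 else 0) - (if i = o.head e then 1 else 0)

/-- The consensus dynamics as a descriptor system in the node states `x` (index `Sum.inl i`) and
the edge states `xᵉ` (index `Sum.inr e`):
`ẋ = K xᵉ`, `0 = K_I x + W xᵉ` with `K = K_Iᵀ` and `W` diagonal with free diagonal entries. -/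
def system (o : EdgeOrientation G) : StructuredSystem (Fin N ⊕ G.edgeSet) where
  QF := Matrix.fromBlocks 1 0 0 0
  QA := Matrix.fromBlocks 0 (incidence o).transpose (incidence o) 0
  TF := fun _ _ => False
  TA := fun a b => ∃ e, a = Sum.inr e ∧ b = Sum.inr e

open scoped Classical in
/-- The matching `m(wᵢᵀ) = wᵢ^Q` for nodes `i` and `m(wₑᵀ) = xₑ^Q` for edges `e`. -/
noncomputable def matching (o : EdgeOrientation G) : (system o).AuxMatching where
  m := Sum.elim (fun i => Sum.inl (Sum.inl i)) (fun e => Sum.inr (Sum.inr e))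
  injective := by
    rintro (i | e) (j | e') h <;> simp_all
  edge := by
    rintro (i | e)
    · exact Or.inl rfl
    · exact Or.inr ⟨Sum.inr e, Or.inl ⟨e, rfl, rfl⟩, rfl⟩
  independent := by
    have h : (system o).Omega.submatrix
        (Sum.elim (fun i => Sum.inl (Sum.inl i)) (fun e => Sum.inr (Sum.inr e))) id =
        Matrix.fromBlocks (-1) (incidence o).transpose 0 1 := by
      ext a b
      rcases a with i | e <;> rcases b with j | e' <;>
        simp [Omega, system, Matrix.one_apply]
    have hu : IsUnit ((system o).Omega.submatrix
        (Sum.elim (fun i => Sum.inl (Sum.inl i)) (fun e => Sum.inr (Sum.inr e))) id) := by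
      rw [h, Matrix.isUnit_iff_isUnit_det, Matrix.det_fromBlocks_zero₂₁]
      simp [Matrix.det_neg]
    exact Matrix.linearIndependent_rows_iff_isUnit.mpr hu

open scoped Classical in
/-- The rank function of `M₁` on sets of nodes. -/
noncomputable def rho₁ (o : EdgeOrientation G) (S : Finset (Fin N)) : ℕ :=
  (system o).rho₁ (S.map Function.Embedding.inl)

open scoped Classical in
/-- The rank function of `M₂` on sets of nodes. -/
noncomputable def rho₂ (o : EdgeOrientation G) (S : Finset (Fin N)) : ℕ :=
  (system o).rho₂ (matching o) (S.map Function.Embedding.inl)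

/-- The constraints `V \ S ∈ M₁* ∩ M₂*` and `|S| ≤ k`. -/
def Feasible (o : EdgeOrientation G) (k : ℕ) (S : Finset (Fin N)) : Prop :=
  RankDualIndep (rho₁ o) Sᶜ ∧ RankDualIndep (rho₂ o) Sᶜ ∧ S.card ≤ k

end Consensus

/-! ### Computation model

A random access machine with finitely many integer registers, integer arrays and real registers
per program. The graph is read through adjacency tests and the objective through a value oracle.
Every elementary instruction, test and oracle call takes one step. The largest integer in memory
grows by at most one per step, so unit cost is adequate. -/

namespace Machine

/-- The contents of the memory. -/
structure Store where
  int : ℕ → ℕ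
  arr : ℕ → ℕ → ℕ
  real : ℕ → ℝ

/-- Tests that control the flow of a program. -/
inductive Test
  | intLt (x y : ℕ)
  | intEq (x y : ℕ)
  | adj (x y : ℕ)
  | realLt (r q : ℕ)

/-- Elementary instructions. -/
inductive Instr
  | zero (x : ℕ)
  | succ (x : ℕ)
  | copy (x y : ℕ)
  | load (x a i : ℕ)
  | store (a i x : ℕ)
  | query (r a : ℕ)
  | realCopy (r q : ℕ)
  | realAdd (r p q : ℕ)
  | realSub (r p q : ℕ)

/-- Programs. -/
inductive Prog
  | instr (c : Instr)
  | seq (P Q : Prog)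
  | cond (b : Test) (P Q : Prog)
  | loop (b : Test) (P : Prog)

variable {N : ℕ}

/-- The set of nodes whose indicator function is array `a`. -/
def Store.set (s : Store) (N a : ℕ) : Finset (Fin N) :=
  Finset.univ.filter (fun v => s.arr a v.val ≠ 0)

/-- The truth value of a test. -/
def Test.holds (G : SimpleGraph (Fin N)) (s : Store) : Test → Prop
  | intLt x y => s.int x < s.int y
  | intEq x y => s.int x = s.int y
  | adj x y => ∃ u v : Fin N, u.val = s.int x ∧ v.val = s.int y ∧ G.Adj u v
  | realLt r q => s.real r < s.real q

/-- The effect of an instruction; `query r a` puts `f(S)` into the real register `r`, where `S` is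
the set held in array `a`. -/
def Instr.run (f : Finset (Fin N) → ℝ) (s : Store) : Instr → Store
  | zero x => { s with int := Function.update s.int x 0 }
  | succ x => { s with int := Function.update s.int x (s.int x + 1) }
  | copy x y => { s with int := Function.update s.int x (s.int y) }
  | load x a i => { s with int := Function.update s.int x (s.arr a (s.int i)) }
  | store a i x =>
      { s with arr := Function.update s.arr a (Function.update (s.arr a) (s.int i) (s.int x)) }
  | query r a => { s with real := Function.update s.real r (f (s.set N a)) }
  | realCopy r q => { s with real := Function.update s.real r (s.real q) }
  | realAdd r p q => { s with real := Function.update s.real r (s.real p + s.real q) }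
  | realSub r p q => { s with real := Function.update s.real r (s.real p - s.real q) }

/-- `Exec G f P s t s'`: started in `s`, program `P` halts in `s'` after exactly `t` steps. -/
inductive Exec (G : SimpleGraph (Fin N)) (f : Finset (Fin N) → ℝ) :
    Prog → Store → ℕ → Store → Prop
  | instr (c : Instr) (s : Store) : Exec G f (.instr c) s 1 (c.run f s)
  | seq {P Q : Prog} {s s₁ s₂ : Store} {t₁ t₂ : ℕ} : Exec G f P s t₁ s₁ → Exec G f Q s₁ t₂ s₂ →
      Exec G f (.seq P Q) s (t₁ + t₂) s₂
  | condTrue {b : Test} {P Q : Prog} {s s₁ : Store} {t : ℕ} : b.holds G s → Exec G f P s t s₁ →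
      Exec G f (.cond b P Q) s (t + 1) s₁
  | condFalse {b : Test} {P Q : Prog} {s s₁ : Store} {t : ℕ} : ¬ b.holds G s →
      Exec G f Q s t s₁ → Exec G f (.cond b P Q) s (t + 1) s₁
  | loopDone {b : Test} {P : Prog} {s : Store} : ¬ b.holds G s → Exec G f (.loop b P) s 1 s
  | loopStep {b : Test} {P : Prog} {s s₁ s₂ : Store} {t₁ t₂ : ℕ} : b.holds G s →
      Exec G f P s t₁ s₁ → Exec G f (.loop b P) s₁ t₂ s₂ →
      Exec G f (.loop b P) s (t₁ + t₂ + 1) s₂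

/-- The initial memory: integer registers `0` and `1` hold `N` and `k`, all else is zero. -/
def initial (N k : ℕ) : Store where
  int := fun x => if x = 0 then N else if x = 1 then k else 0
  arr := fun _ _ => 0
  real := fun _ => 0

/-- On the graph `G`, the bound `k` and the objective `f`, the program `P` halts within `T` steps,
and if the problem of maximizing `f` over the feasible sets has a feasible set at all, then the set
in array `0` is feasible and has at least `α` times the value of every feasible set. -/
def Approximates (P : Prog) (T : ℕ) (α : ℝ) (G : SimpleGraph (Fin N)) (k : ℕ)
    (f : Finset (Fin N) → ℝ) (feasible : Finset (Fin N) → Prop) : Prop :=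
  ∃ (t : ℕ) (s : Store), Exec G f P (initial N k) t s ∧ t ≤ T ∧
    ((∃ S, feasible S) → feasible (s.set N 0) ∧
      ∀ S, feasible S → α * f S ≤ f (s.set N 0))

end Machine

/-!
Both constraints only see the connected components of `G`: `ρ₁(S)` counts the components met by
`S`, and `ρ₂(S)` counts those of them that contain an edge. Hence `S` is feasible iff it meets every
component and has at most `k` elements. The algorithm first chooses the best node among the
components not met so far until all components are met, and then the best remaining node until
`k` nodes are chosen.

For the analysis let `O` be feasible, and let `κ` and `j` be the numbers of elements of `O` and of
the selection in a component. Each element chosen there closes at least a fraction `1 / κ` of the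
gap to `O` in this component, wherever the other choices are made, so the gap decays like
`(1 - 1 / κ) ^ j`. Let `θ` be the largest marginal value at the end. If `j ≥ κ`, the ratio
`1 - 1 / e` is reached in this component and every element beyond the first `κ` has gained another
`θ`. If `j ≤ κ`, the ratio is missed by at most `θ` for every missing element, because the gap is at
most `κ θ` and `(j / κ) (1 - 1 / κ) ^ j ≤ 1 / e`. In the sum over the components the multiples of
`θ` are in favour of the selection, which has at least as many elements as `O`.
-/

/-! ### The rank function of the first matroid -/

section LinearAlgebra

variable {K m n : Type*} [Field K]

theorem exists_linearIndepOn_row_card_eq_rank [Finite m] [Fintype n] (A : Matrix m n K) :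
    ∃ D : Finset m, LinearIndepOn K A.row D ∧ D.card = A.rank := by
  obtain ⟨b, -, -, hspan, hb⟩ := exists_linearIndepOn_extension (linearIndepOn_empty K A.row)
    (Set.empty_subset Set.univ)
  have := Fintype.ofFinite b
  refine ⟨b.toFinset, by simpa using hb, ?_⟩
  have hrange : Submodule.span K (Set.range A.row) =
      Submodule.span K (Set.range fun i : b => A.row i) := by
    rw [← Set.image_univ, ← Set.image_eq_range]
    exact le_antisymm (Submodule.span_le.2 hspan) (Submodule.span_mono (by simp))
  rw [Matrix.rank_eq_finrank_span_row, hrange, finrank_span_eq_card hb, Set.toFinset_card]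

theorem exists_nonsingular_submatrix [Finite m] [Fintype n] (A : Matrix m n K) :
    ∃ (D : Finset m) (R : Finset n), D.card = A.rank ∧ R.card = A.rank ∧
      LinearIndepOn K A.row D ∧ LinearIndepOn K (A.submatrix ((↑) : D → m) id).col R := by
  obtain ⟨D, hD, hDcard⟩ := exists_linearIndepOn_row_card_eq_rank A
  obtain ⟨R, hR, hRcard⟩ :=
    exists_linearIndepOn_row_card_eq_rank (A.submatrix ((↑) : D → m) id).transpose
  have hrank : (A.submatrix ((↑) : D → m) id).rank = D.card := by
    have hrows : LinearIndependent K (A.submatrix ((↑) : D → m) id).row := hD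
    rw [hrows.rank_matrix, Fintype.card_coe]
  rw [Matrix.rank_transpose, hrank, hDcard] at hRcard
  exact ⟨D, R, hDcard, hRcard, hD, hR⟩

theorem linearIndepOn_of_eq_single {γ ι : Type*} [Finite ι] [DecidableEq ι]
    {v : γ → ι → K} {X : Set γ} (g : γ → ι) (hg : Set.InjOn g X)
    (hv : ∀ j ∈ X, v j = Pi.single (g j) 1) : LinearIndepOn K v X := by
  have hsingle := (Pi.basisFun K ι).linearIndependent.comp (fun j : X => g j) hg.injective
  rw [LinearIndepOn]
  convert hsingle using 2 with j
  simp [hv j j.2]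

theorem eq_zero_of_submatrix_combination [DecidableEq m] (A : Matrix m n K)
    {D D' : Finset m} {R : Finset n} (hDD' : Disjoint D D')
    (hR : LinearIndepOn K (A.submatrix ((↑) : D → m) id).col R) {a : m → K} {b : n → K}
    (h : ∀ e, (if e ∈ D' then a e else 0) + ∑ i ∈ R, b i * A e i = 0) :
    (∀ e ∈ D', a e = 0) ∧ ∀ i ∈ R, b i = 0 := by
  have hb : ∀ i ∈ R, b i = 0 := by
    refine linearIndepOn_finset_iff.1 hR b (funext fun e => ?_)
    simpa [Finset.disjoint_left.1 hDD' e.2] using h e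
  refine ⟨fun e he => ?_, hb⟩
  have hsum : ∑ i ∈ R, b i * A e i = 0 := Finset.sum_eq_zero fun i hi => by rw [hb i hi, zero_mul]
  simpa [he, hsum] using h e

end LinearAlgebra

namespace StructuredSystem

/-- The index set of the columns of an augmented matrix `[I | X | Y]`. -/
abbrev AugIndex (ι : Type*) := ι ⊕ (ι ⊕ ι)

theorem ColIndep.mono {ι γ : Type*} {M : Matrix ι γ ℝ} {X Y : Finset γ} (hX : ColIndep M X)
    (hYX : Y ⊆ X) : ColIndep M Y :=
  LinearIndepOn.mono (s := (X : Set γ)) hX hYX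

theorem ColIndep.card_add_card_le {ι γ κ : Type*} [Fintype ι] [Fintype κ] {M : Matrix ι γ ℝ}
    {X : Finset γ} (hX : ColIndep M X) {φ : (ι → ℝ) →ₗ[ℝ] κ → ℝ} (hφ : Function.Surjective φ)
    (hker : ∀ j ∈ X, φ (M.col j) = 0) : X.card + Fintype.card κ ≤ Fintype.card ι := by
  have hlift : LinearIndependent ℝ fun j : X => (⟨M.col j, hker j j.2⟩ : LinearMap.ker φ) :=
    LinearIndependent.of_comp (LinearMap.ker φ).subtype hX
  have hcard : X.card ≤ Module.finrank ℝ (LinearMap.ker φ) := by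
    simpa using hlift.fintype_card_le_finrank
  have hrank := φ.finrank_range_add_finrank_ker
  rw [LinearMap.range_eq_top.2 hφ, finrank_top, Module.finrank_fintype_fun_eq_card,
    Module.finrank_fintype_fun_eq_card] at hrank
  omega

end StructuredSystem

section IndepRank

variable {γ : Type*} [Fintype γ] {I : Finset γ → Prop}

theorem card_le_indepRank {X : Finset γ} (hX : I X) : X.card ≤ indepRank I := by
  classical exact Finset.le_sup (Finset.mem_filter.2 ⟨Finset.mem_univ X, hX⟩)

theorem indepRank_le {n : ℕ} (h : ∀ X, I X → X.card ≤ n) : indepRank I ≤ n := by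
  classical exact Finset.sup_le fun X hX => h X (Finset.mem_filter.1 hX).2

end IndepRank

namespace Consensus

open StructuredSystem

variable {N : ℕ} {G : SimpleGraph (Fin N)}

theorem adj_tail_head (o : EdgeOrientation G) (e : G.edgeSet) : G.Adj (o.tail e) (o.head e) := by
  rw [← SimpleGraph.mem_edgeSet, o.ends e]
  exact e.2

theorem sum_incidence_mul (o : EdgeOrientation G) (e : G.edgeSet) (y : Fin N → ℝ) :
    ∑ i, incidence o e i * y i = y (o.tail e) - y (o.head e) := by
  simp [incidence, sub_mul, Finset.sum_sub_distrib]

theorem incidence_mulVec_eq_zero_iff (o : EdgeOrientation G) {y : Fin N → ℝ} :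
    (incidence o).mulVec y = 0 ↔ ∀ u v, G.Adj u v → y u = y v := by
  simp only [funext_iff, Matrix.mulVec, dotProduct, sum_incidence_mul, Pi.zero_apply, sub_eq_zero]
  refine ⟨fun h u v huv => ?_, fun h e => h _ _ (adj_tail_head o e)⟩
  have hends := h ⟨s(u, v), huv⟩
  obtain ⟨htail, hhead⟩ | ⟨htail, hhead⟩ := Sym2.eq_iff.1 (o.ends ⟨s(u, v), huv⟩)
  all_goals rw [htail, hhead] at hends
  exacts [hends, hends.symm]

-- The incidence matrix has the kernel of the Laplacian, whose dimension is known.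
theorem rank_incidence_add_card (o : EdgeOrientation G) [Finite G.edgeSet]
    [Fintype G.ConnectedComponent] :
    (incidence o).rank + Fintype.card G.ConnectedComponent = N := by
  classical
  have hker : LinearMap.ker (incidence o).mulVecLin =
      LinearMap.ker (Matrix.toLin' (G.lapMatrix ℝ)) := by
    ext y
    rw [LinearMap.mem_ker, LinearMap.mem_ker, Matrix.mulVecLin_apply, Matrix.toLin'_apply,
      incidence_mulVec_eq_zero_iff, G.lapMatrix_mulVec_eq_zero_iff_forall_adj]
  have hrank : (incidence o).rank + Module.finrank ℝ (LinearMap.ker (incidence o).mulVecLin) =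
      Module.finrank ℝ (Fin N → ℝ) := LinearMap.finrank_range_add_finrank_ker _
  rw [Module.finrank_fin_fun, hker,
    ← G.card_connectedComponent_eq_finrank_ker_toLin'_lapMatrix] at hrank
  convert hrank

open scoped Classical in
theorem sum_incidence_component (o : EdgeOrientation G) (e : G.edgeSet)
    (c : G.ConnectedComponent) :
    ∑ i with G.connectedComponentMk i = c, incidence o e i = 0 := by
  have hends := SimpleGraph.ConnectedComponent.sound (adj_tail_head o e).reachable
  rw [Finset.sum_filter]
  simpa [hends] using sum_incidence_mul o e fun i => if G.connectedComponentMk i = c then 1 else 0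

open scoped Classical in
/-- The sums of the node entries of a vector over the connected components in `C`. They vanish
on the columns of `Q_A`, so they bound the rank of the fixed part from above. -/
noncomputable def componentSum (C : Finset G.ConnectedComponent) :
    (Fin N ⊕ G.edgeSet → ℝ) →ₗ[ℝ] C → ℝ :=
  LinearMap.pi fun c => ∑ i with G.connectedComponentMk i = c, LinearMap.proj (Sum.inl i)

open scoped Classical in
theorem componentSum_apply (C : Finset G.ConnectedComponent) (y : Fin N ⊕ G.edgeSet → ℝ) (c : C) :
    componentSum C y c = ∑ i with G.connectedComponentMk i = c, y (Sum.inl i) := by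
  simp [componentSum]

theorem componentSum_surjective (C : Finset G.ConnectedComponent) :
    Function.Surjective (componentSum C) := by
  classical
  intro z
  refine ⟨Sum.elim (fun i => if i = (G.connectedComponentMk i).out then
    Function.extend Subtype.val z 0 (G.connectedComponentMk i) else 0) 0, ?_⟩
  ext c
  have hout : G.connectedComponentMk c.1.out = c := Quot.out_eq _
  rw [componentSum_apply, Finset.sum_eq_single_of_mem c.1.out (by simpa using hout)]
  · simp [hout]
  · rintro i hi hne
    rw [Finset.mem_filter] at hi
    simp [hi.2, hne]

theorem card_le_of_fixedIndep (o : EdgeOrientation G) [Fintype G.edgeSet]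
    (C : Finset G.ConnectedComponent)
    {X : Finset (AugIndex (Fin N ⊕ G.edgeSet))}
    [DecidableEq G.edgeSet] (hX : (system o).FixedIndep X)
    (hXC : ∀ i, Sum.inl (Sum.inl i) ∈ X → G.connectedComponentMk i ∉ C) :
    X.card + C.card ≤ N + Fintype.card G.edgeSet := by
  classical
  suffices h : ∀ j ∈ X, componentSum C ((augmented (system o).QA 0).col j) = 0 by
    simpa using ColIndep.card_add_card_le hX (componentSum_surjective C) h
  intro j hj
  ext c
  rw [componentSum_apply]
  rcases j with (i | e) | (i | e) | j
  · refine Finset.sum_eq_zero fun v hv => ?_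
    have hne : v ≠ i := by
      rintro rfl
      exact hXC v hj ((Finset.mem_filter.1 hv).2 ▸ c.2)
    simp [augmented, hne]
  · simp [augmented]
  · simp [augmented, system]
  · simpa [augmented, system] using sum_incidence_component o e c
  · simp [augmented]

theorem card_le_of_freeIndep (o : EdgeOrientation G) [Fintype G.edgeSet] [DecidableEq G.edgeSet]
    {S U : Finset (Fin N)} (hSU : Disjoint U S)
    {X : Finset (AugIndex (Fin N ⊕ G.edgeSet))}
    (hX : (system o).FreeIndep (S.map .inl) X) (hXU : ∀ i ∈ U, Sum.inl (Sum.inl i) ∉ X) :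
    X.card + U.card ≤ N + Fintype.card G.edgeSet := by
  obtain ⟨TA, TB, hTA, hTB, hind⟩ := hX
  let φ : (Fin N ⊕ G.edgeSet → ℝ) →ₗ[ℝ] U → ℝ := LinearMap.funLeft ℝ ℝ fun i => Sum.inl i.1
  have hφ : Function.Surjective φ := LinearMap.funLeft_surjective_of_injective _ _ _
    (Sum.inl_injective.comp Subtype.val_injective)
  suffices h : ∀ j ∈ X, φ ((augmented TA TB).col j) = 0 by
    simpa using ColIndep.card_add_card_le hind hφ h
  intro j hj
  ext ⟨u, hu⟩
  change augmented TA TB (Sum.inl u) j = 0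
  rcases j with j | j | j
  · have hne : Sum.inl u ≠ j := by
      rintro rfl
      exact hXU u hu hj
    simp [augmented, hne]
  · exact hTA _ _ (by simp [system])
  · refine hTB _ _ fun h => Finset.disjoint_left.1 hSU hu ?_
    simpa using h.2

open scoped Classical in
theorem card_le_of_unionIndep (o : EdgeOrientation G) [Fintype G.edgeSet] (S : Finset (Fin N))
    {X : Finset (AugIndex (Fin N ⊕ G.edgeSet))}
    (hX : UnionIndep (system o).FixedIndep ((system o).FreeIndep (S.map .inl)) X) :
    X.card + Fintype.card G.ConnectedComponent ≤
      2 * (N + Fintype.card G.edgeSet) + (S.image G.connectedComponentMk).card := by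
  obtain ⟨X₁, X₂, hX₁, ⟨TA, TB, hTA, hTB, hX₂⟩, rfl⟩ := hX
  set C := (S.image G.connectedComponentMk)ᶜ
  set U := Finset.univ.filter fun i => G.connectedComponentMk i ∈ C with hU
  -- Outside `Z` the columns of the fixed part satisfy `|C|` linear relations and those of the free
  -- part `|U|` relations, and `Z` has only `|U|` elements.
  let Z : Finset (AugIndex (Fin N ⊕ G.edgeSet)) := (U.disjSum ∅).disjSum ∅
  have hfix : (X₁ \ Z).card + C.card ≤ N + Fintype.card G.edgeSet :=
    card_le_of_fixedIndep o C (ColIndep.mono hX₁ Finset.sdiff_subset) fun i hi hiC =>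
      (Finset.mem_sdiff.1 hi).2 (by simpa [Z, hU] using hiC)
  have hUS : Disjoint U S := Finset.disjoint_left.2 fun i hiU hiS =>
    Finset.mem_compl.1 (Finset.mem_filter.1 hiU).2 (Finset.mem_image_of_mem _ hiS)
  have hfree : (X₂ \ Z).card + U.card ≤ N + Fintype.card G.edgeSet :=
    card_le_of_freeIndep o hUS ⟨TA, TB, hTA, hTB, hX₂.mono Finset.sdiff_subset⟩ fun i hi hiX =>
      (Finset.mem_sdiff.1 hiX).2 (by simpa [Z] using hi)
  have hunion : (X₁ ∪ X₂).card ≤ (X₁ \ Z).card + (X₂ \ Z).card + Z.card := by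
    have hsdiff := Finset.card_le_card_sdiff_add_card (s := X₁ ∪ X₂) (t := Z)
    rw [Finset.union_sdiff_distrib] at hsdiff
    have hle := Finset.card_union_le (X₁ \ Z) (X₂ \ Z)
    omega
  have hZ : Z.card = U.card := by simp [Z]
  have hcompl : (S.image G.connectedComponentMk).card + C.card =
      Fintype.card G.ConnectedComponent := Finset.card_add_card_compl _
  omega

theorem eq_zero_of_incidence_combination (o : EdgeOrientation G) {H : Finset (Fin N)}
    {D : Finset G.edgeSet} (hH : Set.InjOn G.connectedComponentMk H)
    (hD : LinearIndepOn ℝ (incidence o).row D) {a : Fin N → ℝ} {b : G.edgeSet → ℝ}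
    (h : ∀ v, (if v ∈ H then a v else 0) + ∑ e ∈ D, b e * incidence o e v = 0) :
    (∀ v ∈ H, a v = 0) ∧ ∀ e ∈ D, b e = 0 := by
  classical
  have ha : ∀ v ∈ H, a v = 0 := by
    intro v hv
    have hsum : ∑ i with G.connectedComponentMk i = G.connectedComponentMk v,
        ((if i ∈ H then a i else 0) + ∑ e ∈ D, b e * incidence o e i) = 0 :=
      Finset.sum_eq_zero fun i _ => h i
    rw [Finset.sum_add_distrib, Finset.sum_comm] at hsum
    simp_rw [← Finset.mul_sum, sum_incidence_component, mul_zero, Finset.sum_const_zero,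
      add_zero] at hsum
    rwa [Finset.sum_eq_single_of_mem v (by simp), if_pos hv] at hsum
    exact fun i hi hne => if_neg fun hiH => hne (hH hiH hv (Finset.mem_filter.1 hi).2)
  refine ⟨ha, linearIndepOn_finset_iff.1 hD b (funext fun v => ?_)⟩
  have hzero : (if v ∈ H then a v else 0) = 0 := ite_eq_right_iff.2 (ha v)
  simpa [hzero] using h v

theorem fixedIndep_disjSum (o : EdgeOrientation G) [DecidableEq G.edgeSet]
    {H R : Finset (Fin N)} {D D' : Finset G.edgeSet}
    (hH : Set.InjOn G.connectedComponentMk H) (hD : LinearIndepOn ℝ (incidence o).row D)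
    (hR : LinearIndepOn ℝ ((incidence o).submatrix ((↑) : D → G.edgeSet) id).col R)
    (hDD' : Disjoint D D') :
    (system o).FixedIndep ((H.disjSum D').disjSum ((R.disjSum D).disjSum ∅)) := by
  change LinearIndepOn ℝ (augmented (system o).QA 0).col (((H.disjSum D').disjSum
    ((R.disjSum D).disjSum ∅) : Finset (AugIndex (Fin N ⊕ G.edgeSet))) : Set _)
  rw [linearIndepOn_finset_iff]
  intro g hg
  simp only [Finset.sum_disjSum, Finset.sum_empty, add_zero] at hg
  obtain ⟨hgH, hgD⟩ := eq_zero_of_incidence_combination o hH hD (a := fun i => g (.inl (.inl i)))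
    (b := fun e => g (.inr (.inl (.inr e)))) fun v => by
      simpa [augmented, system, Matrix.one_apply] using congrFun hg (Sum.inl v)
  obtain ⟨hgD', hgR⟩ := eq_zero_of_submatrix_combination (incidence o) hDD' hR
    (a := fun e => g (.inl (.inr e))) (b := fun i => g (.inr (.inl (.inl i)))) fun e => by
      simpa [augmented, system, Matrix.one_apply] using congrFun hg (Sum.inr e)
  rintro ((i | e) | (i | e) | j) hj
  · exact hgH i (by simpa using hj)
  · exact hgD' e (by simpa using hj)
  · exact hgR i (by simpa using hj)
  · exact hgD e (by simpa using hj)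
  · simp at hj

theorem freeIndep_disjSum (o : EdgeOrientation G) [Finite G.edgeSet] [DecidableEq G.edgeSet]
    {S H H' : Finset (Fin N)} {D D' : Finset G.edgeSet} (hHS : H ⊆ S) (hH : Disjoint H H')
    (hD : Disjoint D D') :
    (system o).FreeIndep (S.map .inl)
      ((H'.disjSum D).disjSum ((Finset.disjSum ∅ D').disjSum (H.disjSum ∅))) := by
  refine ⟨Matrix.fromBlocks 0 0 0 1, Matrix.diagonal fun i => if i ∈ S.map .inl then 1 else 0,
    ?_, ?_, ?_⟩
  · rintro (i | e) (j | e') h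
    iterate 3 rfl
    exact Matrix.one_apply_ne fun hee => h ⟨e, rfl, congrArg Sum.inr hee.symm⟩
  · intro i j h
    rw [Matrix.diagonal_apply, ite_eq_right_iff]
    exact fun hij => if_neg fun hi => h ⟨hij, hi⟩
  · refine linearIndepOn_of_eq_single (Sum.elim id (Sum.elim id id)) ?_ ?_
    · have h1 := Finset.disjoint_left.1 hH
      have h2 := Finset.disjoint_left.1 hD
      rintro ((i | e) | (i | e) | (i | e)) hi ((j | e') | (j | e') | (j | e')) hj hij <;>
        simp at hi hj hij ⊢ <;> grind
    · rintro ((i | e) | (i | e) | (i | e)) hi <;> simp at hi <;> ext (a | a) <;>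
        simp [augmented, Matrix.one_apply, Matrix.diagonal_apply, Pi.single_apply]
      grind

open scoped Classical in
theorem exists_unionIndep_card_eq (o : EdgeOrientation G) [Fintype G.edgeSet]
    (S : Finset (Fin N)) :
    ∃ X, UnionIndep (system o).FixedIndep ((system o).FreeIndep (S.map .inl)) X ∧
      X.card + Fintype.card G.ConnectedComponent =
        2 * (N + Fintype.card G.edgeSet) + (S.image G.connectedComponentMk).card := by
  obtain ⟨D, R, -, hRcard, hD, hR⟩ := exists_nonsingular_submatrix (incidence o)
  obtain ⟨H, hHS, hHinj, hHim⟩ := Finset.exists_subset_injOn_image_eq_of_surjOn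
    (s := (S : Set (Fin N))) (S.image G.connectedComponentMk)
    (f := G.connectedComponentMk) (by simp [Set.SurjOn])
  have hHcard : H.card = (S.image G.connectedComponentMk).card := by
    rw [← hHim, Finset.card_image_of_injOn hHinj]
  refine ⟨_, ⟨_, _, fixedIndep_disjSum o hHinj hD hR (disjoint_compl_right (a := D)),
    freeIndep_disjSum o (Finset.coe_subset.1 hHS) (disjoint_compl_right (a := H))
      (disjoint_compl_right (a := D)), rfl⟩, ?_⟩
  have hunion : (H.disjSum Dᶜ).disjSum ((R.disjSum D).disjSum (∅ : Finset (Fin N ⊕ G.edgeSet))) ∪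
      (Hᶜ.disjSum D).disjSum ((Finset.disjSum ∅ Dᶜ).disjSum (H.disjSum ∅)) =
      Finset.univ.disjSum ((R.disjSum Finset.univ).disjSum (H.disjSum ∅)) := by
    ext ((i | e) | (i | e) | (i | e)) <;> simp [em, or_comm]
  rw [hunion]
  simp only [Finset.card_disjSum, Finset.card_univ, Fintype.card_sum, Fintype.card_fin,
    Finset.card_empty]
  have := rank_incidence_add_card o
  omega

open scoped Classical in
theorem indepRank_unionIndep (o : EdgeOrientation G) [Fintype G.edgeSet] (S : Finset (Fin N)) :
    indepRank (UnionIndep (system o).FixedIndep ((system o).FreeIndep (S.map .inl))) +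
        Fintype.card G.ConnectedComponent =
      2 * (N + Fintype.card G.edgeSet) + (S.image G.connectedComponentMk).card := by
  obtain ⟨X, hX, hXcard⟩ := exists_unionIndep_card_eq o S
  have hge := card_le_indepRank hX
  have hle := indepRank_le fun Y hY => (Nat.le_sub_of_add_le (card_le_of_unionIndep o S hY))
  omega

open scoped Classical in
theorem rho₁_eq (o : EdgeOrientation G) (S : Finset (Fin N)) :
    rho₁ o S = (S.image G.connectedComponentMk).card := by
  have hS := indepRank_unionIndep o S
  have hempty := indepRank_unionIndep o ∅
  rw [Finset.image_empty, Finset.card_empty, Finset.map_empty] at hempty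
  unfold rho₁ StructuredSystem.rho₁
  omega

end Consensus

/-! ### The rank function of the second matroid -/

section PartitionMatroid

variable {V β : Type*} [DecidableEq β] {p : V → Prop} [DecidablePred p] {c : V → β}
  {ρ : Finset V → ℕ}

theorem rankIndep_iff_of_partition (hρ : ∀ S, ρ S = ((S.filter p).image c).card) {B : Finset V} :
    RankIndep ρ B ↔ (∀ v ∈ B, p v) ∧ Set.InjOn c B := by
  rw [RankIndep, hρ]
  constructor
  · intro h
    have hfilter : (B.filter p).card = B.card :=
      le_antisymm (Finset.card_filter_le _ _) (h ▸ Finset.card_image_le)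
    have hp := Finset.card_filter_eq_iff.1 hfilter
    rw [Finset.filter_true_of_mem hp] at h
    exact ⟨hp, Finset.card_image_iff.1 h⟩
  · rintro ⟨hp, hc⟩
    rw [Finset.filter_true_of_mem hp, Finset.card_image_of_injOn hc]

theorem rankDualIndep_compl_iff_of_partition [Fintype V] [DecidableEq V]
    (hρ : ∀ S, ρ S = ((S.filter p).image c).card) {S : Finset V} :
    RankDualIndep ρ Sᶜ ↔ ∀ v, p v → ∃ s ∈ S, p s ∧ c s = c v := by
  constructor
  · rintro ⟨B, hB, hBS⟩ v hv
    obtain ⟨hBp, hBc⟩ := (rankIndep_iff_of_partition hρ).1 hB.prop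
    by_contra! hvS
    have hcv : ∀ b ∈ B, c b ≠ c v := fun b hb =>
      hvS b (Finset.compl_subset_compl.1 hBS hb) (hBp b hb)
    have hvB : v ∉ B := fun h => hcv v h rfl
    have hind : RankIndep ρ (insert v B) := by
      rw [rankIndep_iff_of_partition hρ, Finset.coe_insert, Set.injOn_insert (by simpa using hvB)]
      exact ⟨by simpa [hv] using hBp, hBc, by simpa using hcv⟩
    exact hvB (hB.le_of_ge hind (Finset.subset_insert v B) (Finset.mem_insert_self v B))
  · intro hS
    obtain ⟨B, hBS, hBc, hBim⟩ := Finset.exists_subset_injOn_image_eq_of_surjOn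
      (S.filter p : Set V) ((S.filter p).image c) (f := c)
      (by rw [Finset.coe_image]; exact Set.surjOn_image _ _)
    rw [Finset.coe_subset] at hBS
    have hBp : ∀ v ∈ B, p v := fun v hv => (Finset.mem_filter.1 (hBS hv)).2
    refine ⟨B, ⟨(rankIndep_iff_of_partition hρ).2 ⟨hBp, hBc⟩, fun B' hB' hBB' v hv => ?_⟩,
      Finset.compl_subset_compl.2 (hBS.trans (Finset.filter_subset _ _))⟩
    obtain ⟨hp, hc⟩ := (rankIndep_iff_of_partition hρ).1 hB'
    obtain ⟨s, hs, hps, hcs⟩ := hS v (hp v hv)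
    obtain ⟨b, hb, hbs⟩ : ∃ b ∈ B, c b = c s := Finset.mem_image.1
      (hBim ▸ Finset.mem_image_of_mem c (Finset.mem_filter.2 ⟨hs, hps⟩))
    rwa [← hc (hBB' hb) hv (hbs.trans hcs)]

end PartitionMatroid

namespace Consensus

open StructuredSystem

variable {N : ℕ} {G : SimpleGraph (Fin N)}

theorem OmegaTilde_eq (o : EdgeOrientation G) [Fintype G.edgeSet] :
    (system o).OmegaTilde (matching o) = Matrix.fromRows
      (Matrix.fromBlocks 1 0 (-incidence o) (incidence o * (incidence o).transpose))
      (Matrix.fromBlocks (-1) (incidence o).transpose 0 1) := by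
  have hJ : (system o).Omega.submatrix (matching o).m id =
      Matrix.fromBlocks (-1) (incidence o).transpose 0 1 := by
    ext (i | e) (j | e') <;> simp [Omega, system, matching, Matrix.one_apply]
  have hinv : ((system o).Omega.submatrix (matching o).m id)⁻¹ =
      Matrix.fromBlocks (-1) (incidence o).transpose 0 1 := by
    apply Matrix.inv_eq_right_inv
    rw [hJ, Matrix.fromBlocks_multiply]
    simp
  have hΩ : (system o).Omega = Matrix.fromRows
      (Matrix.fromBlocks (-1) (incidence o).transpose (incidence o) 0) 1 := by
    ext ((i | e) | a) (j | e') <;> simp [Omega, system]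
  rw [OmegaTilde, hinv, hΩ, Matrix.fromRows_mul, Matrix.one_mul, Matrix.fromBlocks_multiply]
  simp

theorem incidence_ne_zero_iff (o : EdgeOrientation G) {e : G.edgeSet} {i : Fin N} :
    incidence o e i ≠ 0 ↔ i ∈ e.1 := by
  have hne := (adj_tail_head o e).ne
  rw [← o.ends e, Sym2.mem_iff]
  by_cases htail : i = o.tail e <;> by_cases hhead : i = o.head e <;> simp_all [incidence]

-- No cancellation is possible: two different edges share at most one node.
theorem incidence_mul_transpose_ne_zero_iff (o : EdgeOrientation G) {e e' : G.edgeSet} :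
    (incidence o * (incidence o).transpose) e e' ≠ 0 ↔ ∃ i, i ∈ e.1 ∧ i ∈ e'.1 := by
  rw [Matrix.mul_apply]
  simp only [Matrix.transpose_apply]
  constructor
  · intro h
    obtain ⟨i, -, hi⟩ := Finset.exists_ne_zero_of_sum_ne_zero h
    exact ⟨i, by simpa only [← incidence_ne_zero_iff o] using mul_ne_zero_iff.1 hi⟩
  · rintro ⟨i, hi, hi'⟩
    have hi0 := (incidence_ne_zero_iff o).2 hi
    rcases eq_or_ne e e' with rfl | hne
    · exact (Finset.sum_pos' (fun _ _ => mul_self_nonneg _)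
        ⟨i, Finset.mem_univ i, mul_self_pos.2 hi0⟩).ne'
    · rw [Finset.sum_eq_single_of_mem i (Finset.mem_univ i)]
      · exact mul_ne_zero hi0 ((incidence_ne_zero_iff o).2 hi')
      · intro j _ hji
        by_contra hj
        obtain ⟨hj, hj'⟩ := mul_ne_zero_iff.1 hj
        rw [incidence_ne_zero_iff] at hj hj'
        exact hne (Subtype.ext (((Sym2.mem_and_mem_iff hji).1 ⟨hj, hi⟩).trans
          ((Sym2.mem_and_mem_iff hji).1 ⟨hj', hi'⟩).symm))

theorem connectedComponentMk_eq_of_mem {e : G.edgeSet} {i j : Fin N} (hi : i ∈ e.1)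
    (hj : j ∈ e.1) : G.connectedComponentMk i = G.connectedComponentMk j := by
  rcases eq_or_ne i j with rfl | hne
  · rfl
  · refine SimpleGraph.ConnectedComponent.sound (SimpleGraph.Adj.reachable ?_)
    rw [← SimpleGraph.mem_edgeSet, ← (Sym2.mem_and_mem_iff hne).1 ⟨hi, hj⟩]
    exact e.2

theorem exists_adj_of_connectedComponentMk_eq {i j k : Fin N} (hik : G.Adj i k)
    (hij : G.connectedComponentMk i = G.connectedComponentMk j) : ∃ l, G.Adj j l := by
  obtain ⟨p⟩ := (SimpleGraph.ConnectedComponent.exact hij).symm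
  cases p with
  | nil => exact ⟨k, hik⟩
  | cons h _ => exact ⟨_, h⟩

theorem tail_mem (o : EdgeOrientation G) (e : G.edgeSet) : o.tail e ∈ e.1 := by
  rw [← o.ends e]
  exact Sym2.mem_mk_left _ _

section AuxGraph

variable (o : EdgeOrientation G)

/-- The connected component of the node or edge to which a vertex of the auxiliary graph
belongs. The edges of the auxiliary graph preserve it. -/
def auxLabel : AuxVertex (Fin N ⊕ G.edgeSet) → G.ConnectedComponent :=
  let l : Fin N ⊕ G.edgeSet → G.ConnectedComponent :=
    Sum.elim G.connectedComponentMk fun e => G.connectedComponentMk (o.tail e)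
  Sum.elim (Sum.elim l l) (Sum.elim l l)

theorem wQ_notMem_range_matching (e : G.edgeSet) :
    Sum.inl (Sum.inr e) ∉ Set.range (matching o).m := by
  rintro ⟨i | e', h⟩ <;> simp [matching] at h

variable [Fintype G.edgeSet]

theorem auxLabel_eq_of_omegaTilde_ne_zero {v : (Fin N ⊕ G.edgeSet) ⊕ (Fin N ⊕ G.edgeSet)}
    {a : Fin N ⊕ G.edgeSet} (hv : v ∉ Set.range (matching o).m)
    (hva : (system o).OmegaTilde (matching o) v a ≠ 0) :
    auxLabel o (vQ v) = auxLabel o (vQ ((matching o).m a)) := by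
  rw [OmegaTilde_eq] at hva
  rcases v with (i | e) | (i | e)
  · exact (hv ⟨Sum.inl i, rfl⟩).elim
  · rcases a with j | e'
    · have hinc : incidence o e j ≠ 0 := by simpa using hva
      exact connectedComponentMk_eq_of_mem (tail_mem o e) ((incidence_ne_zero_iff o).1 hinc)
    · have hmul : (incidence o * (incidence o).transpose) e e' ≠ 0 := by simpa using hva
      obtain ⟨j, hj, hj'⟩ := (incidence_mul_transpose_ne_zero_iff o).1 hmul
      exact (connectedComponentMk_eq_of_mem (tail_mem o e) hj).trans
        (connectedComponentMk_eq_of_mem hj' (tail_mem o e'))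
  · rcases a with j | e'
    · obtain rfl : i = j := by
        by_contra h
        simp [h] at hva
      rfl
    · have hinc : incidence o e' i ≠ 0 := by simpa using hva
      exact connectedComponentMk_eq_of_mem ((incidence_ne_zero_iff o).1 hinc) (tail_mem o e')
  · exact (hv ⟨Sum.inr e, rfl⟩).elim

theorem auxLabel_eq_of_auxEdge {u v : AuxVertex (Fin N ⊕ G.edgeSet)}
    (h : (system o).AuxEdge (matching o) u v) : auxLabel o u = auxLabel o v := by
  cases h with
  | freeUnmatched i j h _ =>
    obtain ⟨e, rfl, rfl⟩ | ⟨⟨⟩⟩ := h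
    rfl
  | freeMatched i j h _ =>
    obtain ⟨e, rfl, rfl⟩ | ⟨⟨⟩⟩ := h
    rfl
  | copyUnmatched i => rfl
  | copyMatched i => rfl
  | fixed v i hv hvi => exact auxLabel_eq_of_omegaTilde_ne_zero o hv hvi

theorem auxLabel_eq_of_auxReach {u v : AuxVertex (Fin N ⊕ G.edgeSet)}
    (h : (system o).AuxReach (matching o) u v) : auxLabel o u = auxLabel o v := by
  induction h with
  | refl => rfl
  | tail _ h ih => exact ih.trans (auxLabel_eq_of_auxEdge o h)

theorem auxEdge_xQ_wT (e : G.edgeSet) :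
    (system o).AuxEdge (matching o) (vQ (.inr (.inr e))) (wT (.inr e)) :=
  .freeMatched _ _ (Or.inl ⟨e, rfl, rfl⟩) rfl

theorem auxEdge_wT_wQ (e : G.edgeSet) :
    (system o).AuxEdge (matching o) (wT (.inr e)) (vQ (.inl (.inr e))) :=
  .copyUnmatched _ (by simp [matching])

theorem auxEdge_wQ_xQ {e e' : G.edgeSet} {i : Fin N} (hi : i ∈ e.1) (hi' : i ∈ e'.1) :
    (system o).AuxEdge (matching o) (vQ (.inl (.inr e))) (vQ (.inr (.inr e'))) := by
  refine .fixed (Sum.inl (Sum.inr e)) (Sum.inr e') (wQ_notMem_range_matching o e) ?_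
  rw [OmegaTilde_eq]
  simpa using (incidence_mul_transpose_ne_zero_iff o).2 ⟨i, hi, hi'⟩

theorem auxReach_wQ_wT {e : G.edgeSet} {i : Fin N} (hi : i ∈ e.1) :
    (system o).AuxReach (matching o) (vQ (.inl (.inr e))) (wT (.inl i)) := by
  have h : (system o).AuxEdge (matching o) (vQ (.inl (.inr e))) (vQ (.inl (.inl i))) := by
    refine .fixed (Sum.inl (Sum.inr e)) (Sum.inl i) (wQ_notMem_range_matching o e) ?_
    rw [OmegaTilde_eq]
    simpa using (incidence_ne_zero_iff o).2 hi
  exact (Relation.ReflTransGen.single h).tail (.copyMatched _ rfl)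

theorem transGen_wQ_wQ {e e' : G.edgeSet} {i : Fin N} (hi : i ∈ e.1) (hi' : i ∈ e'.1) :
    Relation.TransGen ((system o).AuxEdge (matching o)) (vQ (.inl (.inr e)))
      (vQ (.inl (.inr e'))) :=
  ((Relation.TransGen.single (auxEdge_wQ_xQ o hi hi')).tail (auxEdge_xQ_wT o e')).tail
    (auxEdge_wT_wQ o e')

theorem auxReach_wQ_wQ_of_reachable {u v : Fin N} (h : G.Reachable u v) {e e' : G.edgeSet}
    (hu : u ∈ e.1) (hv : v ∈ e'.1) :
    (system o).AuxReach (matching o) (vQ (.inl (.inr e))) (vQ (.inl (.inr e'))) := by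
  obtain ⟨p⟩ := h
  induction p generalizing e with
  | nil => exact (transGen_wQ_wQ o hu hv).to_reflTransGen
  | @cons u w _ hadj _ ih =>
    exact (transGen_wQ_wQ o hu (e' := ⟨s(u, w), hadj⟩) (Sym2.mem_mk_left u w)).to_reflTransGen.trans
      (ih (Sym2.mem_mk_right u w) hv)

theorem not_auxEdge_wT_node (i : Fin N) (v : AuxVertex (Fin N ⊕ G.edgeSet)) :
    ¬ (system o).AuxEdge (matching o) (wT (.inl i)) v := by
  intro h
  cases h with
  | freeUnmatched _ _ h => obtain ⟨e, ⟨⟩, -⟩ | ⟨⟨⟩⟩ := h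
  | copyUnmatched _ h => exact h rfl

theorem eq_wT_of_auxEdge_wQ_node {i : Fin N} {v : AuxVertex (Fin N ⊕ G.edgeSet)}
    (h : (system o).AuxEdge (matching o) (vQ (.inl (.inl i))) v) : v = wT (.inl i) := by
  cases h with
  | copyMatched => rfl
  | fixed _ _ hv => exact (hv ⟨Sum.inl i, rfl⟩).elim

theorem not_auxEdge_xQ_node (i : Fin N) (v : AuxVertex (Fin N ⊕ G.edgeSet)) :
    ¬ (system o).AuxEdge (matching o) v (vQ (.inr (.inl i))) := by
  intro h
  generalize hw : (vQ (.inr (.inl i)) : AuxVertex (Fin N ⊕ G.edgeSet)) = w at h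
  cases h with
  | freeUnmatched _ _ h =>
    obtain ⟨e, -, rfl⟩ | ⟨⟨⟩⟩ := h
    simp at hw
  | freeMatched => cases hw
  | copyUnmatched => cases hw
  | copyMatched => cases hw
  | fixed v j => rcases j with j | j <;> simp [matching] at hw

theorem exists_wQ_of_auxOnCycle {v : AuxVertex (Fin N ⊕ G.edgeSet)}
    (h : (system o).AuxOnCycle (matching o) v) :
    ∃ e, (system o).AuxReach (matching o) v (vQ (.inl (.inr e))) ∧
      (system o).AuxReach (matching o) (vQ (.inl (.inr e))) v := by
  obtain ⟨w, hvw, hwv⟩ := Relation.TransGen.head'_iff.1 h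
  obtain ⟨u, -, huv⟩ := Relation.TransGen.tail'_iff.1 h
  rcases v with ((i | e) | x) | ((i | e) | (i | e))
  · exact (not_auxEdge_wT_node o i w hvw).elim
  · exact ⟨e, .single (auxEdge_wT_wQ o e),
      .tail (.single (auxEdge_wQ_xQ o (tail_mem o e) (tail_mem o e))) (auxEdge_xQ_wT o e)⟩
  · cases hvw
  · obtain rfl := eq_wT_of_auxEdge_wQ_node o hvw
    obtain ⟨⟨⟩⟩ | ⟨w, hw, -⟩ := Relation.ReflTransGen.cases_head hwv
    exact (not_auxEdge_wT_node o i w hw).elim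
  · exact ⟨e, .refl, .refl⟩
  · exact (not_auxEdge_xQ_node o i u huv).elim
  · exact ⟨e, .tail (.single (auxEdge_xQ_wT o e)) (auxEdge_wT_wQ o e),
      .single (auxEdge_wQ_xQ o (tail_mem o e) (tail_mem o e))⟩

theorem auxReach_of_auxLabel_eq {u v : AuxVertex (Fin N ⊕ G.edgeSet)}
    (hu : (system o).AuxOnCycle (matching o) u) (hv : (system o).AuxOnCycle (matching o) v)
    (h : auxLabel o u = auxLabel o v) : (system o).AuxReach (matching o) u v := by
  obtain ⟨e, hue, -⟩ := exists_wQ_of_auxOnCycle o hu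
  obtain ⟨e', -, hve⟩ := exists_wQ_of_auxOnCycle o hv
  have hl : G.connectedComponentMk (o.tail e) = G.connectedComponentMk (o.tail e') :=
    (auxLabel_eq_of_auxReach o hue).symm.trans (h.trans (auxLabel_eq_of_auxReach o hve).symm)
  exact (hue.trans (auxReach_wQ_wQ_of_reachable o (SimpleGraph.ConnectedComponent.exact hl)
    (tail_mem o e) (tail_mem o e'))).trans hve

/-- The vertices of the auxiliary graph that lie on cycles and belong to the connected component
`c` of `G`. The nonempty sets of this form are the strongly connected components, and each of
them is extremal. -/
def cycleClass (c : G.ConnectedComponent) : Set (AuxVertex (Fin N ⊕ G.edgeSet)) :=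
  {v | (system o).AuxOnCycle (matching o) v ∧ auxLabel o v = c}

theorem auxClass_eq_cycleClass {v : AuxVertex (Fin N ⊕ G.edgeSet)}
    (hv : (system o).AuxOnCycle (matching o) v) :
    (system o).auxClass (matching o) v = cycleClass o (auxLabel o v) := by
  ext u
  constructor
  · rintro ⟨huv, hvu⟩
    exact ⟨Relation.TransGen.trans_right huv (Relation.TransGen.trans_left hv hvu),
      auxLabel_eq_of_auxReach o huv⟩
  · rintro ⟨hu, h⟩
    exact ⟨auxReach_of_auxLabel_eq o hu hv h, auxReach_of_auxLabel_eq o hv hu h.symm⟩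

theorem mem_extremalClasses_iff {C : Set (AuxVertex (Fin N ⊕ G.edgeSet))} :
    C ∈ (system o).extremalClasses (matching o) ↔
      ∃ v, (system o).AuxOnCycle (matching o) v ∧ C = cycleClass o (auxLabel o v) := by
  refine exists_congr fun v => and_congr_right fun hv => ?_
  rw [auxClass_eq_cycleClass o hv, and_iff_left_iff_imp]
  rintro rfl u hu hvu
  exact ⟨hu, (auxLabel_eq_of_auxReach o hvu).symm⟩

theorem exists_adj_of_mem_cycleClass {i : Fin N} {v : AuxVertex (Fin N ⊕ G.edgeSet)}
    (hv : v ∈ cycleClass o (G.connectedComponentMk i)) : ∃ j, G.Adj i j := by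
  obtain ⟨e, hve, -⟩ := exists_wQ_of_auxOnCycle o hv.1
  exact exists_adj_of_connectedComponentMk_eq (adj_tail_head o e)
    ((auxLabel_eq_of_auxReach o hve).symm.trans hv.2)

theorem exists_mem_cycleClass_auxReach_wT {i j : Fin N} (h : G.Adj i j) :
    ∃ v ∈ cycleClass o (G.connectedComponentMk i),
      (system o).AuxReach (matching o) v (wT (.inl i)) := by
  have hi : i ∈ s(i, j) := Sym2.mem_mk_left i j
  have hreach := auxReach_wQ_wT o (e := ⟨s(i, j), h⟩) hi
  exact ⟨_, ⟨transGen_wQ_wQ o hi hi, auxLabel_eq_of_auxReach o hreach⟩, hreach⟩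

open scoped Classical in
theorem system_rho₂_eq (S : Finset (Fin N)) :
    (system o).rho₂ (matching o) (S.map .inl) =
      ((S.filter fun i => ∃ j, G.Adj i j).image
        fun i => cycleClass o (G.connectedComponentMk i)).card := by
  rw [StructuredSystem.rho₂, ← Set.ncard_coe_finset]
  congr 1
  ext C
  simp only [Finset.coe_image, Finset.coe_filter, Set.mem_image, Set.mem_ofPred_eq,
    mem_extremalClasses_iff]
  constructor
  · rintro ⟨⟨v, -, rfl⟩, w, hw, s, hs, hreach⟩
    obtain ⟨i, hi, rfl⟩ := Finset.mem_map.1 hs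
    have hlabel : auxLabel o v = G.connectedComponentMk i :=
      hw.2.symm.trans (auxLabel_eq_of_auxReach o hreach)
    rw [hlabel] at hw ⊢
    exact ⟨i, ⟨hi, exists_adj_of_mem_cycleClass o hw⟩, rfl⟩
  · rintro ⟨i, ⟨hi, j, hij⟩, rfl⟩
    obtain ⟨v, hv, hreach⟩ := exists_mem_cycleClass_auxReach_wT o hij
    exact ⟨⟨v, hv.1, by rw [hv.2]⟩, v, hv, .inl i, Finset.mem_map_of_mem _ hi, hreach⟩

end AuxGraph

theorem feasible_iff (o : EdgeOrientation G) {k : ℕ} {S : Finset (Fin N)} :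
    Feasible o k S ↔ (∀ v, ∃ s ∈ S, G.Reachable s v) ∧ S.card ≤ k := by
  classical
  have hρ₁ : RankDualIndep (rho₁ o) Sᶜ ↔ ∀ v, ∃ s ∈ S, G.Reachable s v := by
    rw [rankDualIndep_compl_iff_of_partition (p := fun _ => True) (c := G.connectedComponentMk)
      fun T => by rw [rho₁_eq, Finset.filter_true]]
    simp
  have hρ₂ : RankDualIndep (rho₂ o) Sᶜ ↔ ∀ v, (∃ j, G.Adj v j) → ∃ s ∈ S, (∃ j, G.Adj s j) ∧
      cycleClass o (G.connectedComponentMk s) = cycleClass o (G.connectedComponentMk v) :=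
    rankDualIndep_compl_iff_of_partition fun T => by
      unfold rho₂
      convert system_rho₂_eq o T
  rw [Feasible, hρ₁, hρ₂]
  refine ⟨fun h => ⟨h.1, h.2.2⟩, fun h => ⟨h.1, ?_, h.2⟩⟩
  rintro v ⟨j, hj⟩
  obtain ⟨s, hs, hsv⟩ := h.1 v
  have hcomp := SimpleGraph.ConnectedComponent.sound hsv
  exact ⟨s, hs, exists_adj_of_connectedComponentMk_eq hj hcomp.symm, by rw [hcomp]⟩

end Consensus

/-! ### Greedy maximization of block-separable submodular functions -/

section Greedy

open Real

theorem one_sub_one_div_pow_le_exp (κ j : ℕ) : (1 - 1 / κ : ℝ) ^ j ≤ exp (-(j / κ)) :=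
  calc (1 - 1 / κ : ℝ) ^ j ≤ exp (-(1 / κ)) ^ j :=
        pow_le_pow_left₀ (Nat.one_sub_one_div_cast_nonneg κ) (one_sub_le_exp_neg _) j
    _ = exp (-(j / κ)) := by rw [← exp_nat_mul]; ring_nf

theorem one_sub_one_div_pow_self_le {κ : ℕ} (hκ : 0 < κ) :
    (1 - 1 / κ : ℝ) ^ κ ≤ 1 / exp 1 := by
  have h := one_sub_one_div_pow_le_exp κ κ
  rwa [div_self (by positivity), exp_neg, ← one_div] at h

theorem div_mul_one_sub_one_div_pow_le (κ j : ℕ) :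
    (j / κ : ℝ) * (1 - 1 / κ) ^ j ≤ 1 / exp 1 := by
  have hlin : (j / κ : ℝ) ≤ exp (j / κ - 1) := by
    simpa using add_one_le_exp ((j / κ : ℝ) - 1)
  calc (j / κ : ℝ) * (1 - 1 / κ) ^ j ≤ exp (j / κ - 1) * exp (-(j / κ)) := by
        gcongr
        · exact pow_nonneg (Nat.one_sub_one_div_cast_nonneg κ) j
        · exact one_sub_one_div_pow_le_exp κ j
    _ = 1 / exp 1 := by
        rw [← exp_add, one_div, ← exp_neg]
        ring_nf

theorem gap_le_of_decay {κ j : ℕ} (hκ : 0 < κ) (hj : j ≤ κ) {gap F θ : ℝ} (hF : 0 ≤ F)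
    (hdecay : gap ≤ (1 - 1 / κ) ^ j * F) (hθ : gap ≤ κ * θ) :
    gap ≤ 1 / exp 1 * F + (κ - j) * θ := by
  have hκ' : (0 : ℝ) < κ := Nat.cast_pos.2 hκ
  have hj' : (0 : ℝ) ≤ κ - j := sub_nonneg.2 (Nat.cast_le.2 hj)
  calc gap = j / κ * gap + (κ - j) * (gap / κ) := by field_simp; ring
    _ ≤ j / κ * ((1 - 1 / κ) ^ j * F) + (κ - j) * θ := by
        gcongr
        exact (div_le_iff₀' hκ').2 hθ
    _ ≤ 1 / exp 1 * F + (κ - j) * θ := by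
        rw [← mul_assoc]
        gcongr
        exact div_mul_one_sub_one_div_pow_le κ j

variable {V β : Type*} {f : Finset V → ℝ} {c : V → β}

section Blocks

variable [DecidableEq β]

/-- The gap to every subset of a block, a fibre of `c`, has decayed geometrically with the number
of elements of `S` in that block. The greedy algorithm maintains this for its selection `S`,
however its picks from different blocks interleave. -/
def GreedyDecay (f : Finset V → ℝ) (c : V → β) (S : Finset V) : Prop :=
  ∀ (b : β) (O : Finset V), O.Nonempty → (∀ v ∈ O, c v = b) →
    f O - f (S.filter (c · = b)) ≤
      (1 - 1 / O.card) ^ (S.filter (c · = b)).card * (f O - f ∅)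

theorem greedyDecay_empty (f : Finset V → ℝ) (c : V → β) : GreedyDecay f c ∅ := by
  intro b O _ _
  simp

variable [Fintype β]

theorem sum_card_block (S : Finset V) :
    ∑ b, ((S.filter (c · = b)).card : ℝ) = S.card := by
  exact_mod_cast (Finset.card_eq_sum_card_fiberwise fun _ _ => Finset.mem_univ _).symm

/-- Up to its value at the empty set, `f` is the sum of its values on the blocks, the fibres of
`c`. -/
def IsBlockSeparable (f : Finset V → ℝ) (c : V → β) : Prop :=
  ∀ S, f S - f ∅ = ∑ b, (f (S.filter (c · = b)) - f ∅)

theorem IsBlockSeparable.sub_eq (hs : IsBlockSeparable f c) {A B : Finset V} (b : β)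
    (h : ∀ b' ≠ b, A.filter (c · = b') = B.filter (c · = b')) :
    f A - f B = f (A.filter (c · = b)) - f (B.filter (c · = b)) := by
  have hA := hs A
  have hB := hs B
  rw [← Finset.add_sum_erase _ _ (Finset.mem_univ b)] at hA hB
  have hrest : ∑ x ∈ Finset.univ.erase b, (f (A.filter (c · = x)) - f ∅) =
      ∑ x ∈ Finset.univ.erase b, (f (B.filter (c · = x)) - f ∅) :=
    Finset.sum_congr rfl fun x hx => by rw [h x (Finset.ne_of_mem_erase hx)]
  linarith

theorem isBlockSeparable_of_isSeparableOverComponents {G : SimpleGraph V}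
    [Fintype G.ConnectedComponent] [DecidableEq G.ConnectedComponent]
    (h : IsSeparableOverComponents G f) : IsBlockSeparable f G.connectedComponentMk := by
  obtain ⟨g, hg⟩ := h
  have hsum : ∀ S, f S = ∑ b, g b (S.filter (G.connectedComponentMk · = b)) := by
    intro S
    rw [hg, finsum_eq_sum_of_fintype]
    refine Finset.sum_congr rfl fun b _ => ?_
    congr
  have hblock : ∀ (S : Finset V) b, f (S.filter (G.connectedComponentMk · = b)) - f ∅ =
      g b (S.filter (G.connectedComponentMk · = b)) - g b ∅ := by
    intro S b
    rw [hsum (S.filter _), hsum ∅, ← Finset.sum_sub_distrib, Finset.sum_eq_single b]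
    · simp [Finset.filter_filter]
    · intro b' _ hb'
      rw [Finset.filter_filter, Finset.filter_false_of_mem, Finset.filter_empty, sub_self]
      rintro v _ ⟨rfl, h⟩
      exact hb' h.symm
    · simp
  intro S
  rw [Finset.sum_congr rfl fun b _ => hblock S b, hsum S, hsum ∅, ← Finset.sum_sub_distrib]
  simp only [Finset.filter_empty]

theorem isBlockSeparable_of_subsingleton [Subsingleton β] (f : Finset V → ℝ) (c : V → β) :
    IsBlockSeparable f c := by
  intro S
  obtain rfl | ⟨v, -⟩ := S.eq_empty_or_nonempty
  · simp
  · rw [Fintype.sum_subsingleton _ (c v),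
      Finset.filter_true_of_mem fun w _ => Subsingleton.elim (c w) (c v)]

end Blocks

variable [DecidableEq V]

theorem IsMonotoneSubmodular.marginal_le (hf : IsMonotoneSubmodular f) {A B : Finset V}
    (hAB : A ⊆ B) (u : V) : f (insert u B) - f B ≤ f (insert u A) - f A := by
  by_cases hu : u ∈ B
  · rw [Finset.insert_eq_of_mem hu, sub_self]
    exact sub_nonneg.2 (hf.mono _ _ (Finset.subset_insert _ _))
  · exact hf.submodular _ _ hAB _ hu

theorem IsMonotoneSubmodular.union_sub_le (hf : IsMonotoneSubmodular f) {S O : Finset V} {g : ℝ}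
    (hg : ∀ u ∈ O, f (insert u S) - f S ≤ g) : f (S ∪ O) - f S ≤ O.card * g := by
  induction O using Finset.induction_on with
  | empty => simp
  | insert u O hu ih =>
    have hO := ih fun w hw => hg w (Finset.mem_insert_of_mem hw)
    have hmarginal := (hf.marginal_le (Finset.subset_union_left (s₁ := S) (s₂ := O)) u).trans
      (hg u (Finset.mem_insert_self u O))
    rw [Finset.union_insert, Finset.card_insert_of_notMem hu]
    push_cast
    linarith

variable [DecidableEq β]

theorem filter_insert_of_block_ne {v : V} {b : β} (h : c v ≠ b) (S : Finset V) :
    (insert v S).filter (c · = b) = S.filter (c · = b) := by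
  rw [Finset.filter_insert, if_neg h]

theorem card_block_insert {S : Finset V} {v : V} (hv : v ∉ S) :
    ((insert v S).filter (c · = c v)).card = (S.filter (c · = c v)).card + 1 := by
  rw [Finset.filter_insert, if_pos rfl, Finset.card_insert_of_notMem (by simp [hv])]

/-- In a block with at least `|O|` elements of `S`, each element beyond the first `|O|` has gained
at least the present marginal value of every `u`, on top of the usual greedy guarantee against `O`.
The greedy algorithm maintains this once it picks from all blocks. -/
def GreedyBalance (f : Finset V → ℝ) (c : V → β) (S : Finset V) : Prop :=
  ∀ (b : β) (O : Finset V) (u : V), O.Nonempty → (∀ v ∈ O, c v = b) →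
    O.card ≤ (S.filter (c · = b)).card →
    (1 - 1 / exp 1) * (f O - f ∅) +
        ((S.filter (c · = b)).card - O.card) * (f (insert u S) - f S) ≤
      f (S.filter (c · = b)) - f ∅

theorem GreedyDecay.le_of_card_eq (hf : IsMonotoneSubmodular f) {S O : Finset V} {b : β}
    (hS : GreedyDecay f c S) (hne : O.Nonempty) (hO : ∀ v ∈ O, c v = b)
    (hcard : O.card = (S.filter (c · = b)).card) :
    (1 - 1 / exp 1) * (f O - f ∅) ≤ f (S.filter (c · = b)) - f ∅ := by
  have hdecay := hS b O hne hO
  rw [← hcard] at hdecay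
  have hexp := mul_le_mul_of_nonneg_right (one_sub_one_div_pow_self_le hne.card_pos)
    (sub_nonneg.2 (hf.mono _ _ (Finset.empty_subset O)))
  linarith

theorem GreedyDecay.balance_of_injOn (hf : IsMonotoneSubmodular f) {S : Finset V}
    (hS : GreedyDecay f c S) (hinj : Set.InjOn c S) : GreedyBalance f c S := by
  intro b O u hne hO hle
  have hblock : (S.filter (c · = b)).card ≤ 1 := by
    rw [Finset.card_le_one]
    intro x hx y hy
    rw [Finset.mem_filter] at hx hy
    exact hinj hx.1 hy.1 (hx.2.trans hy.2.symm)
  have hcard : O.card = (S.filter (c · = b)).card := le_antisymm hle (hblock.trans hne.card_pos)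
  rw [← hcard, sub_self, zero_mul, add_zero]
  exact hS.le_of_card_eq hf hne hO hcard

variable [Fintype β]

theorem IsBlockSeparable.insert_sub_eq (hs : IsBlockSeparable f c) (S : Finset V) (v : V) :
    f (insert v S) - f S =
      f ((insert v S).filter (c · = c v)) - f (S.filter (c · = c v)) :=
  hs.sub_eq (c v) fun _ h => filter_insert_of_block_ne h.symm S

theorem IsBlockSeparable.sub_block_le (hf : IsMonotoneSubmodular f) (hs : IsBlockSeparable f c)
    {S O : Finset V} {b : β} {g : ℝ} (hO : ∀ v ∈ O, c v = b)
    (hg : ∀ u, c u = b → f (insert u S) - f S ≤ g) :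
    f O - f (S.filter (c · = b)) ≤ O.card * g := by
  refine le_trans ?_ (hf.union_sub_le fun u hu => hg u (hO u hu))
  rw [hs.sub_eq (A := S ∪ O) (B := S) b]
  · refine sub_le_sub_right (hf.mono _ _ fun v hv => ?_) _
    simp [hv, hO v hv]
  · intro b' hb'
    rw [Finset.filter_union, Finset.filter_false_of_mem (s := O), Finset.union_empty]
    intro v hv hvb
    exact hb' (hvb.symm.trans (hO v hv))

theorem GreedyDecay.insert_best (hf : IsMonotoneSubmodular f) (hs : IsBlockSeparable f c)
    {S : Finset V} {v : V} (hS : GreedyDecay f c S) (hv : v ∉ S)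
    (hbest : ∀ u, c u = c v → f (insert u S) ≤ f (insert v S)) :
    GreedyDecay f c (insert v S) := by
  intro b O hne hO
  by_cases hb : c v = b
  · subst hb
    have hκ : (0 : ℝ) < O.card := Nat.cast_pos.2 hne.card_pos
    have hgain : (f O - f (S.filter (c · = c v))) / O.card ≤ f (insert v S) - f S :=
      (div_le_iff₀' hκ).2 (hs.sub_block_le hf hO fun u hu => sub_le_sub_right (hbest u hu) _)
    rw [hs.insert_sub_eq S v] at hgain
    calc f O - f ((insert v S).filter (c · = c v))
        ≤ (1 - 1 / O.card) * (f O - f (S.filter (c · = c v))) := by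
          rw [one_sub_mul, one_div_mul_eq_div]
          linarith
      _ ≤ (1 - 1 / O.card) *
            ((1 - 1 / O.card) ^ (S.filter (c · = c v)).card * (f O - f ∅)) :=
          mul_le_mul_of_nonneg_left (hS (c v) O hne hO) (Nat.one_sub_one_div_cast_nonneg _)
      _ = _ := by rw [card_block_insert hv, pow_succ', mul_assoc]
  · rw [filter_insert_of_block_ne hb]
    exact hS b O hne hO

theorem GreedyBalance.insert_best (hf : IsMonotoneSubmodular f) (hs : IsBlockSeparable f c)
    {S : Finset V} {v : V} (hS : GreedyBalance f c S) (hS' : GreedyDecay f c (insert v S))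
    (hv : v ∉ S) (hbest : ∀ u, f (insert u S) ≤ f (insert v S)) :
    GreedyBalance f c (insert v S) := by
  intro b O u hne hO hle
  have hmarginal := hf.marginal_le (Finset.subset_insert v S) u
  by_cases hb : c v = b
  · subst hb
    rcases hle.eq_or_lt with heq | hlt
    · rw [← heq, sub_self, zero_mul, add_zero]
      exact hS'.le_of_card_eq hf hne hO heq
    · rw [card_block_insert hv] at hlt ⊢
      have hold := hS (c v) O v hne hO (Nat.lt_succ_iff.1 hlt)
      have hgain := hs.insert_sub_eq S v
      have hsurplus : (0 : ℝ) ≤ (S.filter (c · = c v)).card + 1 - O.card :=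
        sub_nonneg.2 (by exact_mod_cast hlt.le)
      have hmul := mul_le_mul_of_nonneg_left
        (hmarginal.trans (sub_le_sub_right (hbest u) (f S))) hsurplus
      push_cast
      linarith
  · rw [filter_insert_of_block_ne hb] at hle ⊢
    have hold := hS b O u hne hO hle
    have hmul := mul_le_mul_of_nonneg_left hmarginal (sub_nonneg.2 (Nat.cast_le (α := ℝ).2 hle))
    linarith

theorem GreedyBalance.block_le_add_deficit (hf : IsMonotoneSubmodular f)
    (hs : IsBlockSeparable f c) {S : Finset V} (hB : GreedyBalance f c S) (hD : GreedyDecay f c S)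
    {u : V} (hu : ∀ w, f (insert w S) ≤ f (insert u S)) {O : Finset V} {b : β}
    (hne : O.Nonempty) (hO : ∀ v ∈ O, c v = b) :
    (1 - 1 / exp 1) * (f O - f ∅) ≤ f (S.filter (c · = b)) - f ∅ +
      (O.card - (S.filter (c · = b)).card) * (f (insert u S) - f S) := by
  rcases le_total O.card (S.filter (c · = b)).card with hle | hle
  · linarith [hB b O u hne hO hle]
  · have hgap := gap_le_of_decay hne.card_pos hle
      (sub_nonneg.2 (hf.mono _ _ (Finset.empty_subset O))) (hD b O hne hO)
      (hs.sub_block_le hf hO fun w _ => sub_le_sub_right (hu w) (f S))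
    linarith

theorem GreedyBalance.le_of_card_le [Finite V] (hf : IsMonotoneSubmodular f)
    (hs : IsBlockSeparable f c) {S O : Finset V} (hB : GreedyBalance f c S)
    (hD : GreedyDecay f c S) (hO : ∀ b, (O.filter (c · = b)).Nonempty)
    (hcard : O.card ≤ S.card) :
    (1 - 1 / exp 1) * f O ≤ f S := by
  have hempty : (1 - 1 / exp 1) * f ∅ ≤ f ∅ :=
    mul_le_of_le_one_left (hf.nonneg ∅) (sub_le_self 1 (by positivity))
  obtain hV | hV := isEmpty_or_nonempty V
  · rwa [Subsingleton.elim S ∅, Subsingleton.elim O ∅]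
  obtain ⟨u, hu⟩ := Finite.exists_max fun u => f (insert u S)
  have hsum := Finset.sum_le_sum fun b (_ : b ∈ Finset.univ) =>
    hB.block_le_add_deficit hf hs hD hu (hO b) fun v hv => (Finset.mem_filter.1 hv).2
  rw [← Finset.mul_sum, Finset.sum_add_distrib, ← Finset.sum_mul, ← hs O, ← hs S,
    Finset.sum_sub_distrib, sum_card_block, sum_card_block] at hsum
  have hdeficit : ((O.card : ℝ) - S.card) * (f (insert u S) - f S) ≤ 0 :=
    mul_nonpos_of_nonpos_of_nonneg (sub_nonpos.2 (Nat.cast_le.2 hcard))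
      (sub_nonneg.2 (hf.mono _ _ (Finset.subset_insert _ _)))
  linarith

end Greedy

/-! ### Sets closed under adjacency -/

section Reachability

variable {V : Type*} {G : SimpleGraph V} {R R' R'' : Finset V}

/-- The set `R'` arises from `R` by adding vertices that are reachable from it. This relates the
successive contents of an array in which reachable nodes are collected. -/
def Expands (G : SimpleGraph V) (R R' : Finset V) : Prop :=
  R ⊆ R' ∧ ∀ v ∈ R', ∃ u ∈ R, G.Reachable u v

theorem Expands.refl (R : Finset V) : Expands G R R :=
  ⟨subset_rfl, fun v hv => ⟨v, hv, .refl v⟩⟩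

theorem Expands.trans (h : Expands G R R') (h' : Expands G R' R'') : Expands G R R'' := by
  refine ⟨h.1.trans h'.1, fun v hv => ?_⟩
  obtain ⟨u, hu, huv⟩ := h'.2 v hv
  obtain ⟨w, hw, hwu⟩ := h.2 u hu
  exact ⟨w, hw, hwu.trans huv⟩

theorem Expands.insert_of_adj [DecidableEq V] {u v : V} (hu : u ∈ R) (h : G.Adj u v) :
    Expands G R (insert v R) := by
  refine ⟨Finset.subset_insert _ _, fun w hw => ?_⟩
  rcases Finset.mem_insert.1 hw with rfl | hw
  · exact ⟨u, hu, h.reachable⟩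
  · exact ⟨w, hw, .refl w⟩

/-- Every neighbour of a vertex in `R` lies in `R`. -/
def IsClosedUnderAdj (G : SimpleGraph V) (R : Finset V) : Prop :=
  ∀ u ∈ R, ∀ v, G.Adj u v → v ∈ R

theorem IsClosedUnderAdj.mem_of_reachable (hR : IsClosedUnderAdj G R) {u v : V} (hu : u ∈ R)
    (h : G.Reachable u v) : v ∈ R := by
  obtain ⟨p⟩ := h
  induction p with
  | nil => exact hu
  | cons h _ ih => exact ih (hR _ hu _ h)

theorem IsClosedUnderAdj.eq_of_expands (hR : IsClosedUnderAdj G R) (h : Expands G R R') :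
    R' = R := by
  refine subset_antisymm (fun v hv => ?_) h.1
  obtain ⟨u, hu, huv⟩ := h.2 v hv
  exact hR.mem_of_reachable hu huv

theorem IsClosedUnderAdj.mem_iff_of_expands (hR' : IsClosedUnderAdj G R') (h : Expands G R R')
    (v : V) : v ∈ R' ↔ ∃ u ∈ R, G.Reachable u v :=
  ⟨h.2 v, fun ⟨_, hu, huv⟩ => hR'.mem_of_reachable (h.1 hu) huv⟩

theorem card_le_of_injOn_component {S O : Finset V} (hS : Set.InjOn G.connectedComponentMk S)
    (hO : ∀ v, ∃ u ∈ O, G.Reachable u v) : S.card ≤ O.card := by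
  choose g hgO hg using hO
  refine Finset.card_le_card_of_injOn g (fun v _ => hgO v) fun s hs s' hs' h => ?_
  exact hS hs hs' (SimpleGraph.ConnectedComponent.sound ((hg s).symm.trans (h ▸ hg s')))

end Reachability

namespace Machine

variable {N : ℕ} {G : SimpleGraph (Fin N)} {f : Finset (Fin N) → ℝ}

/-! ### Total correctness with time bounds -/

/-- Started in `s`, the program halts within `T` steps in a store that satisfies `Q`: a Hoare
triple for total correctness with a time bound. -/
def Halts (G : SimpleGraph (Fin N)) (f : Finset (Fin N) → ℝ) (P : Prog) (s : Store) (T : ℕ)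
    (Q : Store → Prop) : Prop :=
  ∃ t s', Exec G f P s t s' ∧ t ≤ T ∧ Q s'

namespace Halts

variable {P P' : Prog} {b : Test} {s : Store} {T T' : ℕ} {Q R : Store → Prop}

theorem mono (h : Halts G f P s T Q) (hT : T ≤ T') (hQ : ∀ s', Q s' → R s') :
    Halts G f P s T' R := by
  obtain ⟨t, s', he, ht, hq⟩ := h
  exact ⟨t, s', he, ht.trans hT, hQ s' hq⟩

theorem instr {c : Instr} (h : Q (c.run f s)) : Halts G f (.instr c) s (T + 1) Q :=
  ⟨1, _, .instr c s, Nat.le_add_left 1 T, h⟩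

theorem seq (h : Halts G f P s T R) (h' : ∀ s', R s' → Halts G f P' s' T' Q) :
    Halts G f (.seq P P') s (T + T') Q := by
  obtain ⟨t, s₁, he, ht, hr⟩ := h
  obtain ⟨t', s₂, he', ht', hq⟩ := h' s₁ hr
  exact ⟨t + t', s₂, .seq he he', Nat.add_le_add ht ht', hq⟩

theorem instr_seq {c : Instr} (h : Halts G f P (c.run f s) T Q) :
    Halts G f (.seq (.instr c) P) s (T + 1) Q :=
  (seq (instr (T := 0) (Q := (· = c.run f s)) rfl) fun _ hs => hs ▸ h).mono
    (by omega) fun _ => id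

theorem cond (h : b.holds G s → Halts G f P s T Q) (h' : ¬ b.holds G s → Halts G f P' s T Q) :
    Halts G f (.cond b P P') s (T + 1) Q := by
  by_cases hb : b.holds G s
  · obtain ⟨t, s₁, he, ht, hq⟩ := h hb
    exact ⟨t + 1, s₁, .condTrue hb he, Nat.add_le_add_right ht 1, hq⟩
  · obtain ⟨t, s₁, he, ht, hq⟩ := h' hb
    exact ⟨t + 1, s₁, .condFalse hb he, Nat.add_le_add_right ht 1, hq⟩

theorem loop_done (hb : ¬ b.holds G s) (h : Q s) : Halts G f (.loop b P) s 1 Q :=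
  ⟨1, s, .loopDone hb, le_rfl, h⟩

theorem loop_step (hb : b.holds G s) (h : Halts G f P s T R)
    (h' : ∀ s', R s' → Halts G f (.loop b P) s' T' Q) :
    Halts G f (.loop b P) s (T + T' + 1) Q := by
  obtain ⟨t, s₁, he, ht, hr⟩ := h
  obtain ⟨t', s₂, he', ht', hq⟩ := h' s₁ hr
  exact ⟨t + t' + 1, s₂, .loopStep hb he he', by omega, hq⟩

end Halts

/-- Run `B` with register `i` counting from `0` up to the contents of register `0`. -/
def forLoop (i : ℕ) (B : Prog) : Prog :=
  .seq (.instr (.zero i)) (.loop (.intLt i 0) (.seq B (.instr (.succ i))))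

theorem Halts.forLoop {i : ℕ} {B : Prog} {s : Store} {T : ℕ} (Inv : ℕ → Store → Prop)
    (hinit : Inv 0 ((Instr.zero i).run f s))
    (hcount : ∀ j s, Inv j s → s.int i = j ∧ s.int 0 = N)
    (hstep : ∀ (j : Fin N) (s : Store), Inv j s →
      Halts G f B s T fun s' => Inv (j + 1) ((Instr.succ i).run f s')) :
    Halts G f (forLoop i B) s (N * (T + 2) + 2) (Inv N) := by
  have hloop : ∀ m j s, j + m = N → Inv j s →
      Halts G f (.loop (.intLt i 0) (.seq B (.instr (.succ i)))) s (m * (T + 2) + 1) (Inv N) := by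
    intro m
    induction m with
    | zero =>
      rintro j s rfl hs
      obtain ⟨hi, h0⟩ := hcount j s hs
      refine (Halts.loop_done ?_ hs).mono (by omega) fun _ => id
      simp only [Test.holds]
      omega
    | succ m ih =>
      intro j s hj hs
      obtain ⟨hi, h0⟩ := hcount j s hs
      refine (Halts.loop_step ?_ ((hstep ⟨j, by omega⟩ s hs).seq (T' := 1) fun _ => .instr (T := 0))
        fun s' hs' => ih (j + 1) s' (by omega) hs').mono (by rw [Nat.succ_mul]; omega) fun _ => id
      simp only [Test.holds]
      omega
  exact (Halts.instr_seq (hloop N 0 _ (zero_add N) hinit)).mono (by omega) fun _ => id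

/-! ### The greedy program

Register `0` holds `N`, register `1` the bound `k`, register `2` counts rounds, registers `3`, `4`
and `5` are loop variables, register `6` holds the best candidate (`N` as long as there is none),
register `7` the number of selected nodes, registers `8` and `9` the constants one and zero.
Array `0` is the selected set and array `1` the set of nodes in the components it meets. The real
register `0` holds the value of the best candidate, the real register `1` that of the present
one. -/

/-- An instruction that changes nothing as long as register `9` holds zero. -/
def skip : Prog := .instr (.zero 9)

/-- Evaluate the selected set together with the node in register `3`. -/
def probe : Prog :=
  .seq (.instr (.store 0 3 8)) (.seq (.instr (.query 1 0)) (.instr (.store 0 3 9)))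

/-- Make the node in register `3` the best candidate. -/
def take : Prog := .seq (.instr (.copy 6 3)) (.instr (.realCopy 0 1))

/-- Make the node in register `3` the best candidate if there is none or a worse one. -/
def compare : Prog := .cond (.intEq 6 0) take (.cond (.realLt 0 1) take skip)

/-- Compare the node in register `3` with the best candidate, unless it is marked in array `m`. -/
def scanBody (m : ℕ) : Prog :=
  .seq (.instr (.load 10 m 3)) (.cond (.intEq 10 9) (.seq probe compare) skip)

/-- Find the best candidate among the nodes that are not marked in array `m`. -/
def select (m : ℕ) : Prog := .seq (.instr (.copy 6 0)) (forLoop 3 (scanBody m))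

/-- Run `P` on the best candidate among the nodes that are not marked in array `m`, if there is
one. -/
def selectAndThen (m : ℕ) (P : Prog) : Prog := .seq (select m) (.cond (.intLt 6 0) P skip)

/-- Add the best candidate to the selected set. -/
def insertBest : Prog := .seq (.instr (.store 0 6 8)) (.instr (.succ 7))

/-- If the node in register `4` is in array `1`, add its neighbour in register `5`. -/
def expandBody : Prog :=
  .seq (.instr (.load 10 1 4)) <| .cond (.intEq 10 9) skip
    (.cond (.adj 4 5) (.instr (.store 1 5 8)) skip)

/-- If the node in register `4` is in array `1`, add all its neighbours. -/
def expand : Prog := forLoop 5 expandBody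

/-- Add all neighbours of array `1` to array `1`. -/
def sweep : Prog := forLoop 4 expand

/-- Close array `1` under adjacency. -/
def close : Prog := forLoop 3 sweep

/-- Select the best node in the components that have not been met yet. -/
def coverRound : Prog :=
  selectAndThen 1 (.seq insertBest (.seq (.instr (.store 1 6 8)) close))

/-- Select the best remaining node if fewer than `k` nodes have been selected. -/
def fillRound : Prog := .cond (.intLt 7 1) (selectAndThen 0 insertBest) skip

/-- The greedy algorithm: meet all components first, then use up the bound `k`. -/
def greedy : Prog :=
  .seq (.instr (.succ 8)) (.seq (forLoop 2 coverRound) (forLoop 2 fillRound))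

/-! ### Representation of the selection in the store -/

/-- The store holds the selected set `S`, the set `R` of covered nodes and the round counter `t`. -/
structure Rep (k t : ℕ) (S R : Finset (Fin N)) (s : Store) : Prop where
  size : s.int 0 = N
  bound : s.int 1 = k
  round : s.int 2 = t
  count : s.int 7 = S.card
  one : s.int 8 = 1
  zero : s.int 9 = 0
  selected : s.set N 0 = S
  covered : s.set N 1 = R

section Store

variable {s : Store}

theorem mem_set {a : ℕ} {v : Fin N} : v ∈ s.set N a ↔ s.arr a v ≠ 0 := by
  simp [Store.set]

theorem set_store_insert {a i x : ℕ} {v : Fin N} (hi : s.int i = v) (hx : s.int x ≠ 0) :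
    ((Instr.store a i x).run f s).set N a = insert v (s.set N a) := by
  ext u
  rw [Finset.mem_insert, mem_set, mem_set]
  by_cases h : u = v
  · simp [Instr.run, hi, h, hx]
  · simp [Instr.run, hi, h, Fin.val_inj]

theorem set_store_erase {a i x : ℕ} {v : Fin N} (hi : s.int i = v) (hx : s.int x = 0) :
    ((Instr.store a i x).run f s).set N a = (s.set N a).erase v := by
  ext u
  rw [Finset.mem_erase, mem_set, mem_set]
  by_cases h : u = v
  · simp [Instr.run, hi, h, hx]
  · simp [Instr.run, hi, h, Fin.val_inj]

theorem set_store_of_ne {a a' i x : ℕ} (h : a' ≠ a) :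
    ((Instr.store a i x).run f s).set N a' = s.set N a' := by
  ext u
  simp [mem_set, Instr.run, h]

theorem holds_intEq_load_iff {a i x z : ℕ} {v : Fin N} (hi : s.int i = v) (hz : s.int z = 0)
    (hzx : z ≠ x) :
    (Test.intEq x z).holds G ((Instr.load x a i).run f s) ↔ v ∉ s.set N a := by
  simp [Test.holds, Instr.run, mem_set, hi, hz, hzx]

theorem holds_adj_iff {x y : ℕ} {u v : Fin N} (hx : s.int x = u) (hy : s.int y = v) :
    (Test.adj x y).holds G s ↔ G.Adj u v := by
  constructor
  · rintro ⟨u', v', hu', hv', h⟩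
    rwa [Fin.ext (hu'.trans hx), Fin.ext (hv'.trans hy)] at h
  · exact fun h => ⟨u, v, hx.symm, hy.symm, h⟩

end Store

theorem forall_lt_succ_iff {v : Fin N} {p : Fin N → Prop} :
    (∀ u : Fin N, u.val < v + 1 → p u) ↔ (∀ u : Fin N, u.val < v → p u) ∧ p v := by
  simp only [Nat.lt_succ_iff_lt_or_eq, Fin.val_inj, or_imp, forall_and, forall_eq]

variable {k t : ℕ} {S R : Finset (Fin N)} {s s' : Store}

namespace Rep

theorem congr (h : Rep k t S R s) (h0 : s'.int 0 = s.int 0 := by rfl)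
    (h1 : s'.int 1 = s.int 1 := by rfl) (h2 : s'.int 2 = s.int 2 := by rfl)
    (h7 : s'.int 7 = s.int 7 := by rfl) (h8 : s'.int 8 = s.int 8 := by rfl)
    (h9 : s'.int 9 = s.int 9 := by rfl) (hsel : s'.set N 0 = s.set N 0 := by rfl)
    (hcov : s'.set N 1 = s.set N 1 := by rfl) : Rep k t S R s' :=
  ⟨h0.trans h.size, h1.trans h.bound, h2.trans h.round, h7.trans h.count, h8.trans h.one,
    h9.trans h.zero, hsel.trans h.selected, hcov.trans h.covered⟩

theorem skip (h : Rep k t S R s) : Rep k t S R ((Instr.zero 9).run f s) :=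
  h.congr (h9 := h.zero.symm)

theorem succ_round (h : Rep k t S R s) : Rep k (t + 1) S R ((Instr.succ 2).run f s) :=
  ⟨h.size, h.bound, congrArg Nat.succ h.round, h.count, h.one, h.zero, h.selected, h.covered⟩

theorem zero_round (h : Rep k t S R s) : Rep k 0 S R ((Instr.zero 2).run f s) :=
  ⟨h.size, h.bound, rfl, h.count, h.one, h.zero, h.selected, h.covered⟩

theorem one_ne_zero (h : Rep k t S R s) : s.int 8 ≠ 0 := by
  rw [h.one]
  exact Nat.one_ne_zero

theorem store_selected {v : Fin N} (h : Rep k t S R s) (h6 : s.int 6 = v) (hv : v ∉ S) :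
    Rep k t (insert v S) R ((Instr.succ 7).run f ((Instr.store 0 6 8).run f s)) where
  __ := h
  count := by
    rw [Finset.card_insert_of_notMem hv]
    exact congrArg Nat.succ h.count
  selected := by
    rw [← h.selected]
    exact set_store_insert (f := f) (a := 0) h6 h.one_ne_zero
  covered := (set_store_of_ne (f := f) (a := 0) (i := 6) (x := 8) Nat.one_ne_zero).trans h.covered

theorem store_covered {v : Fin N} {i : ℕ} (h : Rep k t S R s) (hi : s.int i = v) :
    Rep k t S (insert v R) ((Instr.store 1 i 8).run f s) where
  __ := h
  selected := (set_store_of_ne Nat.zero_ne_one).trans h.selected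
  covered := h.covered ▸ set_store_insert hi h.one_ne_zero

end Rep

/-! ### Searching the best candidate -/

/-- Among the nodes below `j` outside `M`, the node `x` is one whose addition to `S` has the
largest value, and `q` is this value; if there is no such node, `x` is the out-of-range number
`N`. -/
def IsBest (f : Finset (Fin N) → ℝ) (S M : Finset (Fin N)) (j x : ℕ) (q : ℝ) : Prop :=
  (x = N ∧ ∀ u : Fin N, u.val < j → u ∈ M) ∨
    ∃ v : Fin N, x = v ∧ v ∉ M ∧ q = f (insert v S) ∧
      ∀ u : Fin N, u.val < j → u ∉ M → f (insert u S) ≤ q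

namespace IsBest

variable {M : Finset (Fin N)} {v : Fin N} {j x : ℕ} {q : ℝ}

theorem le_of_notMem (h : IsBest f S M j x q) (hx : x ≠ N) {u : Fin N} (hu : u.val < j)
    (huM : u ∉ M) : f (insert u S) ≤ q := by
  obtain ⟨hN, -⟩ | ⟨v, -, -, -, hle⟩ := h
  · exact (hx hN).elim
  · exact hle u hu huM

theorem mem_of_eq (h : IsBest f S M j x q) (hx : x = N) {u : Fin N} (hu : u.val < j) :
    u ∈ M := by
  obtain ⟨-, hM⟩ | ⟨v, hv, -⟩ := h
  · exact hM u hu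
  · exact (v.2.ne (hv.symm.trans hx)).elim

theorem succ_of_mem (h : IsBest f S M v x q) (hv : v ∈ M) : IsBest f S M (v + 1) x q := by
  obtain ⟨hx, hM⟩ | ⟨w, hw, hwM, hq, hle⟩ := h
  · exact .inl ⟨hx, forall_lt_succ_iff.2 ⟨hM, hv⟩⟩
  · exact .inr ⟨w, hw, hwM, hq, forall_lt_succ_iff.2 ⟨hle, fun h => (h hv).elim⟩⟩

theorem succ_of_le (h : IsBest f S M v x q) (hx : x ≠ N) (hv : f (insert v S) ≤ q) :
    IsBest f S M (v + 1) x q := by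
  obtain ⟨hN, -⟩ | ⟨w, hw, hwM, hq, hle⟩ := h
  · exact (hx hN).elim
  · exact .inr ⟨w, hw, hwM, hq, forall_lt_succ_iff.2 ⟨hle, fun _ => hv⟩⟩

theorem self (hv : v ∉ M)
    (hle : ∀ u : Fin N, u.val < v → u ∉ M → f (insert u S) ≤ f (insert v S)) :
    IsBest f S M (v + 1) v (f (insert v S)) :=
  .inr ⟨v, rfl, hv, rfl, forall_lt_succ_iff.2 ⟨hle, fun _ => le_rfl⟩⟩

end IsBest

theorem halts_probe {v : Fin N} (h : Rep k t S R s) (h3 : s.int 3 = v) (hv : v ∉ S) :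
    Halts G f probe s 3 fun s' => Rep k t S R s' ∧ s'.int 3 = v ∧ s'.int 6 = s.int 6 ∧
      s'.real 0 = s.real 0 ∧ s'.real 1 = f (insert v S) := by
  have hmark : ((Instr.store 0 3 8).run f s).set N 0 = insert v S :=
    h.selected ▸ set_store_insert h3 h.one_ne_zero
  refine .instr_seq (.instr_seq (.instr ⟨h.congr (hsel := ?_) (hcov := ?_), h3, rfl, rfl, ?_⟩))
  · rw [h.selected, ← Finset.erase_insert hv, ← hmark]
    exact set_store_erase (f := f) (a := 0) (i := 3) (x := 9)
      (s := (Instr.query 1 0).run f ((Instr.store 0 3 8).run f s)) h3 h.zero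
  · exact (set_store_of_ne Nat.one_ne_zero).trans
      (set_store_of_ne (f := f) (s := s) (i := 3) (x := 8) Nat.one_ne_zero)
  · rw [← hmark]
    rfl

theorem halts_take {v : Fin N} {M : Finset (Fin N)} (h : Rep k t S R s) (h3 : s.int 3 = v)
    (hv : v ∉ M) (hreal : s.real 1 = f (insert v S))
    (hle : ∀ u : Fin N, u.val < v → u ∉ M → f (insert u S) ≤ f (insert v S)) :
    Halts G f take s 2 fun s' =>
      Rep k t S R s' ∧ s'.int 3 = v ∧ IsBest f S M (v + 1) (s'.int 6) (s'.real 0) := by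
  refine .instr_seq (.instr ⟨h.congr, h3, ?_⟩)
  convert IsBest.self hv hle using 1
  · exact h3
  · exact hreal

theorem halts_compare {v : Fin N} {M : Finset (Fin N)} (h : Rep k t S R s) (h3 : s.int 3 = v)
    (hv : v ∉ M) (hreal : s.real 1 = f (insert v S))
    (hbest : IsBest f S M v (s.int 6) (s.real 0)) :
    Halts G f compare s 4 fun s' =>
      Rep k t S R s' ∧ s'.int 3 = v ∧ IsBest f S M (v + 1) (s'.int 6) (s'.real 0) := by
  have hnone : (Test.intEq 6 0).holds G s ↔ s.int 6 = N := by
    simp only [Test.holds, h.size]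
  have hworse : (Test.realLt 0 1).holds G s ↔ s.real 0 < f (insert v S) := by
    rw [← hreal, Test.holds]
  refine .cond (fun h6 => ?_) fun h6 => .cond (fun hlt => ?_) fun hlt => ?_
  · exact (halts_take h h3 hv hreal fun u hu huM =>
      (huM (hbest.mem_of_eq (hnone.1 h6) hu)).elim).mono (by omega) fun _ => id
  · exact halts_take h h3 hv hreal fun u hu huM =>
      (hbest.le_of_notMem (mt hnone.2 h6) hu huM).trans (hworse.1 hlt).le
  · exact .instr ⟨h.skip, h3, hbest.succ_of_le (mt hnone.2 h6) (not_lt.1 (mt hworse.2 hlt))⟩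

theorem halts_scanBody {m : ℕ} {v : Fin N} {M : Finset (Fin N)} (h : Rep k t S R s)
    (hm : s.set N m = M) (hSM : S ⊆ M) (h3 : s.int 3 = v)
    (hbest : IsBest f S M v (s.int 6) (s.real 0)) :
    Halts G f (scanBody m) s 9 fun s' =>
      Rep k t S R s' ∧ s'.int 3 = v ∧ IsBest f S M (v + 1) (s'.int 6) (s'.real 0) := by
  have hunmarked := hm ▸ holds_intEq_load_iff (G := G) (f := f) (a := m) (x := 10) h3 h.zero
    (by norm_num)
  have hload : Rep k t S R ((Instr.load 10 m 3).run f s) := h.congr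
  refine .instr_seq (.cond (fun h10 => ?_) fun h10 => ?_)
  · have hv := hunmarked.1 h10
    refine (halts_probe hload h3 fun hvS => hv (hSM hvS)).seq (T' := 4) ?_
    rintro s' ⟨h', h3', h6', hreal₀, hreal₁⟩
    exact halts_compare h' h3' hv hreal₁ (by rw [h6', hreal₀]; exact hbest)
  · exact .instr ⟨hload.skip, h3, hbest.succ_of_mem (not_not.1 (mt hunmarked.2 h10))⟩

theorem halts_select {m : ℕ} {M : Finset (Fin N)} (h : Rep k t S R s)
    (hm : ∀ s, Rep k t S R s → s.set N m = M) (hSM : S ⊆ M) :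
    Halts G f (select m) s (N * 11 + 3) fun s' =>
      Rep k t S R s' ∧ IsBest f S M N (s'.int 6) (s'.real 0) := by
  refine .instr_seq ((Halts.forLoop (T := 9) (fun j s => Rep k t S R s ∧ s.int 3 = j ∧
    IsBest f S M j (s.int 6) (s.real 0)) ?_ ?_ ?_).mono le_rfl ?_)
  · exact ⟨h.congr, rfl, .inl ⟨h.size, fun u hu => (Nat.not_lt_zero _ hu).elim⟩⟩
  · rintro j s ⟨h, h3, -⟩
    exact ⟨h3, h.size⟩
  · rintro j s ⟨h, h3, hbest⟩
    refine (halts_scanBody h (hm s h) hSM h3 hbest).mono le_rfl ?_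
    rintro s' ⟨h', h3', hbest'⟩
    exact ⟨h'.congr, congrArg Nat.succ h3', hbest'⟩
  · rintro s' ⟨h', -, hbest⟩
    exact ⟨h', hbest⟩

theorem halts_selectAndThen {m : ℕ} {M : Finset (Fin N)} {P : Prog} {T : ℕ} {Q : Store → Prop}
    (h : Rep k t S R s) (hm : ∀ s, Rep k t S R s → s.set N m = M) (hSM : S ⊆ M)
    (hbest : ∀ s' (v : Fin N), Rep k t S R s' → s'.int 6 = v → v ∉ M →
      (∀ u ∉ M, f (insert u S) ≤ f (insert v S)) → Halts G f P s' (T + 1) Q)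
    (hnone : ∀ s', Rep k t S R s' → M = Finset.univ → Q s') :
    Halts G f (selectAndThen m P) s (N * 11 + 3 + (T + 2)) Q := by
  refine (halts_select h hm hSM).seq ?_
  rintro s' ⟨h', hs'⟩
  have hfound : (Test.intLt 6 0).holds G s' ↔ s'.int 6 < N := by
    simp only [Test.holds, h'.size]
  refine .cond (fun h6 => ?_) fun h6 => .instr ?_
  all_goals
    rw [hfound] at h6
    obtain ⟨hN, hM⟩ | ⟨v, hv, hvM, hq, hle⟩ := hs'
  · exact (h6.ne hN).elim
  · exact hbest s' v h' hv hvM fun u huM => hq ▸ hle u u.2 huM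
  · exact hnone _ h'.skip (Finset.eq_univ_iff_forall.2 fun u => hM u u.2)
  · exact (h6 (hv ▸ v.2)).elim

theorem halts_insertBest {v : Fin N} (h : Rep k t S R s) (h6 : s.int 6 = v) (hv : v ∉ S) :
    Halts G f insertBest s 2 fun s' => Rep k t (insert v S) R s' ∧ s'.int 6 = v :=
  .instr_seq (.instr ⟨h.store_selected h6 hv, h6⟩)

/-! ### Closing a set under adjacency -/

theorem halts_expandBody {a : ℕ} {u v : Fin N} (h : Rep k t S R s) (h3 : s.int 3 = a)
    (h4 : s.int 4 = u) (h5 : s.int 5 = v) :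
    Halts G f expandBody s 4 fun s' => ∃ R', Rep k t S R' s' ∧ s'.int 3 = a ∧ s'.int 4 = u ∧
      s'.int 5 = v ∧ Expands G R R' ∧ (u ∈ R → G.Adj u v → v ∈ R') := by
  have hload : Rep k t S R ((Instr.load 10 1 4).run f s) := h.congr
  have huR := h.covered ▸ holds_intEq_load_iff (G := G) (f := f) (a := 1) (x := 10) h4 h.zero
    (by norm_num)
  have hadj : (Test.adj 4 5).holds G ((Instr.load 10 1 4).run f s) ↔ G.Adj u v :=
    holds_adj_iff h4 h5
  refine .instr_seq (.cond (fun hu => ?_) fun hu => .cond (fun huv => ?_) fun huv => ?_)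
  · exact .instr ⟨R, hload.skip, h3, h4, h5, .refl R, fun hu' => (huR.1 hu hu').elim⟩
  · exact .instr ⟨insert v R, hload.store_covered h5, h3, h4, h5,
      .insert_of_adj (not_not.1 (mt huR.2 hu)) (hadj.1 huv), fun _ _ => Finset.mem_insert_self _ _⟩
  · exact .instr ⟨R, hload.skip, h3, h4, h5, .refl R, fun _ huv' => (huv (hadj.2 huv')).elim⟩

theorem halts_expand {a : ℕ} {u : Fin N} (h : Rep k t S R s) (h3 : s.int 3 = a)
    (h4 : s.int 4 = u) :
    Halts G f expand s (N * 6 + 2) fun s' => ∃ R', Rep k t S R' s' ∧ s'.int 3 = a ∧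
      s'.int 4 = u ∧ Expands G R R' ∧ (u ∈ R → ∀ v, G.Adj u v → v ∈ R') := by
  refine (Halts.forLoop (T := 4) (fun j s => ∃ R', Rep k t S R' s ∧ s.int 3 = a ∧ s.int 4 = u ∧
    s.int 5 = j ∧ Expands G R R' ∧ (u ∈ R → ∀ v : Fin N, v.val < j → G.Adj u v → v ∈ R'))
    ?_ ?_ ?_).mono le_rfl ?_
  · exact ⟨R, h.congr, h3, h4, rfl, .refl R, fun _ v hv => (Nat.not_lt_zero _ hv).elim⟩
  · rintro j s ⟨R', h, -, -, h5, -⟩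
    exact ⟨h5, h.size⟩
  · rintro v s ⟨R₁, h, h3, h4, h5, hE, hA⟩
    refine (halts_expandBody h h3 h4 h5).mono le_rfl ?_
    rintro s' ⟨R₂, h', h3', h4', h5', hE', hA'⟩
    exact ⟨R₂, h'.congr, h3', h4', congrArg Nat.succ h5', hE.trans hE', fun hu =>
      forall_lt_succ_iff.2 ⟨fun w hw hadj => hE'.1 (hA hu w hw hadj), hA' (hE.1 hu)⟩⟩
  · rintro s' ⟨R', h', h3', h4', -, hE, hA⟩
    exact ⟨R', h', h3', h4', hE, fun hu v => hA hu v v.2⟩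

theorem halts_sweep {a : ℕ} (h : Rep k t S R s) (h3 : s.int 3 = a) :
    Halts G f sweep s (N * (N * 6 + 4) + 2) fun s' => ∃ R', Rep k t S R' s' ∧ s'.int 3 = a ∧
      Expands G R R' ∧ ∀ u ∈ R, ∀ v, G.Adj u v → v ∈ R' := by
  refine (Halts.forLoop (T := N * 6 + 2) (fun j s => ∃ R', Rep k t S R' s ∧ s.int 3 = a ∧
    s.int 4 = j ∧ Expands G R R' ∧
      ∀ u : Fin N, u.val < j → u ∈ R → ∀ v, G.Adj u v → v ∈ R') ?_ ?_ ?_).mono le_rfl ?_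
  · exact ⟨R, h.congr, h3, rfl, .refl R, fun v hv => (Nat.not_lt_zero _ hv).elim⟩
  · rintro j s ⟨R', h, -, h4, -⟩
    exact ⟨h4, h.size⟩
  · rintro u s ⟨R₁, h, h3, h4, hE, hA⟩
    refine (halts_expand h h3 h4).mono le_rfl ?_
    rintro s' ⟨R₂, h', h3', h4', hE', hA'⟩
    exact ⟨R₂, h'.congr, h3', congrArg Nat.succ h4', hE.trans hE', forall_lt_succ_iff.2
      ⟨fun w hw hwR v hadj => hE'.1 (hA w hw hwR v hadj), fun hu => hA' (hE.1 hu)⟩⟩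
  · rintro s' ⟨R', h', h3', -, hE, hA⟩
    exact ⟨R', h', h3', hE, fun u => hA u u.2⟩

theorem eq_univ_of_le_card (hR : N ≤ R.card) : R = Finset.univ :=
  Finset.eq_univ_of_card R (le_antisymm (Finset.card_le_univ R) (by rwa [Fintype.card_fin]))

theorem halts_close (h : Rep k t S R s) :
    Halts G f close s (N * (N * (N * 6 + 4) + 4) + 2) fun s' => ∃ R', Rep k t S R' s' ∧
      ∀ v, v ∈ R' ↔ ∃ u ∈ R, G.Reachable u v := by
  -- A sweep that leaves the set unclosed has added a node, so `N` sweeps are enough.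
  refine (Halts.forLoop (T := N * (N * 6 + 4) + 2) (fun j s => ∃ R', Rep k t S R' s ∧
    s.int 3 = j ∧ Expands G R R' ∧ (IsClosedUnderAdj G R' ∨ j ≤ R'.card)) ?_ ?_ ?_).mono le_rfl ?_
  · exact ⟨R, h.congr, rfl, .refl R, .inr (Nat.zero_le _)⟩
  · rintro j s ⟨R', h, h3, -⟩
    exact ⟨h3, h.size⟩
  · rintro j s ⟨R₁, h, h3, hE, hC⟩
    refine (halts_sweep h h3).mono le_rfl ?_
    rintro s' ⟨R₂, h', h3', hE', hA⟩
    refine ⟨R₂, h'.congr, congrArg Nat.succ h3', hE.trans hE', ?_⟩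
    obtain rfl | hne := eq_or_ne R₁ R₂
    · exact .inl hA
    · have hj : j ≤ R₁.card := hC.resolve_left fun hC => hne (hC.eq_of_expands hE').symm
      exact .inr (hj.trans_lt (Finset.card_lt_card (hE'.1.ssubset_of_ne hne)))
  · rintro s' ⟨R', h', -, hE, hC⟩
    refine ⟨R', h', IsClosedUnderAdj.mem_iff_of_expands (hC.elim id fun hcard => ?_) hE⟩
    rw [eq_univ_of_le_card hcard]
    exact fun _ _ v _ => Finset.mem_univ v

/-! ### The two phases -/

variable [DecidableEq G.ConnectedComponent]

/-- The invariant of the first phase: `R` is the union of the components met by `S`, each of which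
contains exactly one node of `S`. -/
structure CoverInv (G : SimpleGraph (Fin N)) [DecidableEq G.ConnectedComponent]
    (f : Finset (Fin N) → ℝ) (S R : Finset (Fin N)) : Prop where
  mem_iff : ∀ v, v ∈ R ↔ ∃ s ∈ S, G.Reachable s v
  injOn : Set.InjOn G.connectedComponentMk S
  decay : GreedyDecay f G.connectedComponentMk S

theorem CoverInv.subset (h : CoverInv G f S R) : S ⊆ R :=
  fun v hv => (h.mem_iff v).2 ⟨v, hv, .refl v⟩

/-- The invariant of the second phase, which starts with `m` selected nodes. -/
structure FillInv (G : SimpleGraph (Fin N)) [DecidableEq G.ConnectedComponent]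
    (f : Finset (Fin N) → ℝ) (k m t : ℕ) (S : Finset (Fin N)) : Prop where
  reachable : ∀ v, ∃ s ∈ S, G.Reachable s v
  decay : GreedyDecay f G.connectedComponentMk S
  balance : GreedyBalance f G.connectedComponentMk S
  card_le : S.card ≤ max k m
  le_card : min k t ≤ S.card

theorem CoverInv.fillInv (hf : IsMonotoneSubmodular f) (h : CoverInv G f S Finset.univ) :
    FillInv G f k S.card 0 S :=
  ⟨fun v => (h.mem_iff v).1 (Finset.mem_univ v), h.decay, h.decay.balance_of_injOn hf h.injOn,
    le_max_right _ _, by simp⟩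

variable [Fintype G.ConnectedComponent]

theorem CoverInv.insert_best (hf : IsMonotoneSubmodular f)
    (hs : IsBlockSeparable f G.connectedComponentMk) (h : CoverInv G f S R) {v : Fin N}
    (hv : v ∉ R) (hbest : ∀ u ∉ R, f (insert u S) ≤ f (insert v S)) {R' : Finset (Fin N)}
    (hR' : ∀ w, w ∈ R' ↔ ∃ u ∈ insert v R, G.Reachable u w) : CoverInv G f (insert v S) R' := by
  have hne : ∀ u ∈ R, G.connectedComponentMk u ≠ G.connectedComponentMk v := by
    intro u hu huv
    obtain ⟨s, hs, hsu⟩ := (h.mem_iff u).1 hu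
    exact hv ((h.mem_iff v).2 ⟨s, hs, hsu.trans (SimpleGraph.ConnectedComponent.exact huv)⟩)
  have hvS : v ∉ S := fun hvS => hv (h.subset hvS)
  refine ⟨fun w => ?_, ?_, ?_⟩
  · simp only [hR', Finset.exists_mem_insert, h.mem_iff]
    refine or_congr_right ⟨?_, fun ⟨s, hs, hsw⟩ => ⟨s, ⟨s, hs, .refl s⟩, hsw⟩⟩
    rintro ⟨u, ⟨s, hs, hsu⟩, huw⟩
    exact ⟨s, hs, hsu.trans huw⟩
  · rw [Finset.coe_insert, Set.injOn_insert (by exact_mod_cast hvS)]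
    refine ⟨h.injOn, ?_⟩
    rintro ⟨u, hu, huv⟩
    exact hne u (h.subset hu) huv
  · exact h.decay.insert_best hf hs hvS fun u hu => hbest u fun huR => hne u huR hu

theorem FillInv.insert_best (hf : IsMonotoneSubmodular f)
    (hs : IsBlockSeparable f G.connectedComponentMk) {m : ℕ} (h : FillInv G f k m t S)
    (hk : S.card < k) {v : Fin N} (hv : v ∉ S)
    (hbest : ∀ u ∉ S, f (insert u S) ≤ f (insert v S)) : FillInv G f k m (t + 1) (insert v S) := by
  have hbest' : ∀ u, f (insert u S) ≤ f (insert v S) := by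
    intro u
    by_cases hu : u ∈ S
    · rw [Finset.insert_eq_of_mem hu]
      exact hf.mono _ _ (Finset.subset_insert _ _)
    · exact hbest u hu
  have hdecay : GreedyDecay f G.connectedComponentMk (insert v S) :=
    h.decay.insert_best hf hs hv fun u _ => hbest' u
  have hcard := Finset.card_insert_of_notMem hv
  have hle := h.le_card
  refine ⟨fun w => ?_, hdecay, h.balance.insert_best hf hs hdecay hv hbest', by omega, by omega⟩
  obtain ⟨s, hs, hsw⟩ := h.reachable w
  exact ⟨s, Finset.mem_insert_of_mem hs, hsw⟩

theorem halts_coverRound (hf : IsMonotoneSubmodular f)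
    (hs : IsBlockSeparable f G.connectedComponentMk) (ht : t < N) (h : Rep k t S R s)
    (hI : CoverInv G f S R) (hcard : t ≤ R.card) :
    Halts G f coverRound s (N * 11 + 3 + (N * (N * (N * 6 + 4) + 4) + 6)) fun s' =>
      ∃ S R, Rep k t S R s' ∧ CoverInv G f S R ∧ t + 1 ≤ R.card := by
  refine halts_selectAndThen h (fun _ h => h.covered) hI.subset
    (fun s₁ v h₁ h6 hv hbest => ?_) fun s₁ h₁ hR => ⟨S, R, h₁, hI, ?_⟩
  · refine ((halts_insertBest h₁ h6 fun hvS => hv (hI.subset hvS)).seq ?_).mono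
      (T := 2 + (N * (N * (N * 6 + 4) + 4) + 2 + 1)) (by omega) fun _ => id
    rintro s₂ ⟨h₂, h6⟩
    refine .instr_seq ((halts_close (h₂.store_covered h6)).mono le_rfl ?_)
    rintro s₃ ⟨R', h₃, hR'⟩
    refine ⟨_, R', h₃, hI.insert_best hf hs hv hbest hR', ?_⟩
    have hsub : insert v R ⊆ R' := fun u hu => (hR' u).2 ⟨u, hu, .refl u⟩
    have hle := Finset.card_le_card hsub
    rw [Finset.card_insert_of_notMem hv] at hle
    omega
  · rwa [hR, Finset.card_univ, Fintype.card_fin]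

theorem halts_fillRound (hf : IsMonotoneSubmodular f)
    (hs : IsBlockSeparable f G.connectedComponentMk) {m : ℕ} (ht : t < N) (h : Rep k t S R s)
    (hI : FillInv G f k m t S) :
    Halts G f fillRound s (N * 11 + 7) fun s' =>
      ∃ S R, Rep k t S R s' ∧ FillInv G f k m (t + 1) S := by
  have hroom : (Test.intLt 7 1).holds G s ↔ S.card < k := by
    simp only [Test.holds, h.count, h.bound]
  have hfull (hk : min k (t + 1) ≤ S.card) : FillInv G f k m (t + 1) S := { hI with le_card := hk }
  refine .cond (fun hk => (halts_selectAndThen h (fun _ h => h.selected) subset_rfl (T := 1)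
    (Q := fun s' => ∃ S R, Rep k t S R s' ∧ FillInv G f k m (t + 1) S)
    (fun s₁ v h₁ h6 hv hbest => ?_) fun s₁ h₁ hS => ⟨S, R, h₁, hfull ?_⟩).mono (by omega)
    fun _ => id) fun hk => .instr ⟨S, R, h.skip, hfull ?_⟩
  · refine (halts_insertBest h₁ h6 hv).mono le_rfl ?_
    rintro s₂ ⟨h₂, -⟩
    exact ⟨_, R, h₂, hI.insert_best hf hs (hroom.1 hk) hv hbest⟩
  · rw [hS, Finset.card_univ, Fintype.card_fin]
    omega
  · rw [hroom] at hk
    omega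

theorem halts_cover (hf : IsMonotoneSubmodular f)
    (hs : IsBlockSeparable f G.connectedComponentMk) (h : Rep k t (∅ : Finset (Fin N)) ∅ s) :
    Halts G f (forLoop 2 coverRound) s
      (N * (N * 11 + 3 + (N * (N * (N * 6 + 4) + 4) + 6) + 2) + 2) fun s' =>
      ∃ S, Rep k N S Finset.univ s' ∧ CoverInv G f S Finset.univ := by
  refine (Halts.forLoop (fun j s => ∃ S R, Rep k j S R s ∧ CoverInv G f S R ∧ j ≤ R.card)
    ?_ ?_ ?_).mono le_rfl ?_
  · exact ⟨∅, ∅, h.zero_round, ⟨by simp, by simp, greedyDecay_empty _ _⟩, le_rfl⟩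
  · rintro j s ⟨S, R, h, -⟩
    exact ⟨h.round, h.size⟩
  · rintro j s ⟨S, R, h, hI, hcard⟩
    refine (halts_coverRound hf hs j.2 h hI hcard).mono le_rfl ?_
    rintro s' ⟨S', R', h', hI', hcard'⟩
    exact ⟨S', R', h'.succ_round, hI', hcard'⟩
  · rintro s' ⟨S, R, h, hI, hcard⟩
    obtain rfl := eq_univ_of_le_card hcard
    exact ⟨S, h, hI⟩

theorem halts_fill (hf : IsMonotoneSubmodular f)
    (hs : IsBlockSeparable f G.connectedComponentMk) {m : ℕ} (h : Rep k t S R s)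
    (hI : FillInv G f k m 0 S) :
    Halts G f (forLoop 2 fillRound) s (N * (N * 11 + 9) + 2) fun s' =>
      FillInv G f k m N (s'.set N 0) := by
  refine (Halts.forLoop (fun j s => ∃ S R, Rep k j S R s ∧ FillInv G f k m j S)
    ?_ ?_ ?_).mono le_rfl ?_
  · exact ⟨S, R, h.zero_round, hI⟩
  · rintro j s ⟨S, R, h, -⟩
    exact ⟨h.round, h.size⟩
  · rintro j s ⟨S, R, h, hI⟩
    refine (halts_fillRound hf hs j.2 h hI).mono le_rfl ?_
    rintro s' ⟨S', R', h', hI'⟩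
    exact ⟨S', R', h'.succ_round, hI'⟩
  · rintro s' ⟨S, R, h, hI⟩
    rwa [h.selected]

/-- A bound for the number of steps of the greedy algorithm on a graph with `N` nodes, as a
polynomial in `N`. -/
noncomputable def greedyTime : Polynomial ℕ :=
  6 * .X ^ 4 + 4 * .X ^ 3 + 26 * .X ^ 2 + 20 * .X + 5

theorem halts_greedy (hf : IsMonotoneSubmodular f)
    (hs : IsBlockSeparable f G.connectedComponentMk) (k : ℕ) :
    Halts G f greedy (initial N k) (greedyTime.eval N) fun s' =>
      ∃ S₀ : Finset (Fin N), Set.InjOn G.connectedComponentMk S₀ ∧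
        FillInv G f k S₀.card N (s'.set N 0) := by
  have hinit : Rep k 0 (∅ : Finset (Fin N)) ∅ ((Instr.succ 8).run f (initial N k)) := by
    refine ⟨rfl, rfl, rfl, rfl, rfl, rfl, ?_, ?_⟩ <;> ext v <;>
      simp [mem_set, Instr.run, initial]
  refine (Halts.instr_seq ((halts_cover hf hs hinit).seq fun s₁ ⟨S₀, h₀, hI₀⟩ =>
    (halts_fill hf hs h₀ (hI₀.fillInv hf)).mono le_rfl fun _ hI => ⟨S₀, hI₀.injOn, hI⟩)).mono
    (le_of_eq ?_) fun _ => id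
  simp only [greedyTime, Polynomial.eval_add, Polynomial.eval_mul, Polynomial.eval_pow,
    Polynomial.eval_X, Polynomial.eval_ofNat]
  ring

theorem approximates_greedy (o : EdgeOrientation G) (hf : IsMonotoneSubmodular f)
    (hs : IsBlockSeparable f G.connectedComponentMk) (k : ℕ) :
    Approximates greedy (greedyTime.eval N) (1 - 1 / Real.exp 1) G k f
      (Consensus.Feasible o k) := by
  obtain ⟨t, s, he, ht, S₀, hinj, hI⟩ := halts_greedy hf hs k
  refine ⟨t, s, he, ht, ?_⟩
  simp only [Consensus.feasible_iff]
  rintro ⟨O, hO, hOk⟩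
  have hS₀ : S₀.card ≤ k := (card_le_of_injOn_component hinj hO).trans hOk
  refine ⟨⟨hI.reachable, hI.card_le.trans (max_le le_rfl hS₀)⟩, ?_⟩
  rintro O' ⟨hO', hOk'⟩
  have hcard : O'.card ≤ min k N := le_min hOk' (by simpa using Finset.card_le_univ O')
  refine hI.balance.le_of_card_le hf hs hI.decay (fun b => ?_) (hcard.trans hI.le_card)
  induction b using SimpleGraph.ConnectedComponent.ind with | h v =>
  obtain ⟨u, hu, huv⟩ := hO' v
  exact ⟨u, Finset.mem_filter.2 ⟨hu, SimpleGraph.ConnectedComponent.sound huv⟩⟩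

end Machine

theorem theorem5p5 :
    (∃ (P : Machine.Prog) (p : Polynomial ℕ),
      ∀ (N : ℕ) (G : SimpleGraph (Fin N)) (o : EdgeOrientation G) (k : ℕ)
        (f : Finset (Fin N) → ℝ), IsMonotoneSubmodular f → IsSeparableOverComponents G f →
        Machine.Approximates P (p.eval N) (1 - 1 / Real.exp 1) G k f (Consensus.Feasible o k)) ∧
    (∃ (P : Machine.Prog) (p : Polynomial ℕ),
      ∀ (N : ℕ) (G : SimpleGraph (Fin N)) (o : EdgeOrientation G), G.Preconnected →
        ∀ (k : ℕ) (f : Finset (Fin N) → ℝ), IsMonotoneSubmodular f →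
        Machine.Approximates P (p.eval N) (1 - 1 / Real.exp 1) G k f (Consensus.Feasible o k)) := by
  classical
  refine ⟨⟨Machine.greedy, Machine.greedyTime, fun N G o k f hf hs => ?_⟩,
    ⟨Machine.greedy, Machine.greedyTime, fun N G o hG k f hf => ?_⟩⟩
  · exact Machine.approximates_greedy o hf (isBlockSeparable_of_isSeparableOverComponents hs) k
  · have := hG.subsingleton_connectedComponent
    exact Machine.approximates_greedy o hf (isBlockSeparable_of_subsingleton f _) k
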